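/- **Setting.** Let $(\Omega,\Upsilon,P)$ be a probability space, $(\mathcal X,\mathcal A)$ a measurable space, $(X_{i,n})_{1\le i\le n,\ n\in\mathbb N}$ (with $\mathbb N=\{1,2,\dots\}$) an array of $\mathcal X$-valued random variables on $\Omega$, and $\mathcal F$ a family of measurable maps $\mathcal X\to\mathbb R$ with a finite envelope: there is a measurable $B:\mathcal X\to\mathbb R$ with $|f(x)|\le B(x)$ for all $f\in\mathcal F$, $x\in\mathcal X$, such that $B(X_{i,n})$ is integrable for all $1\le i\le n$. The sequential empirical process is $$\mathbb Z_n(t,f)=\frac1{\sqrt n}\sum_{i=1}^{\lfloor nt\rfloor}\bigl(f(X_{i,n})-\mathrm E f(X_{i,n})\bigr),\qquad t\in[0,1],\ f\in\mathcal F,$$ regarded as a (possibly nonmeasurable) map $\Omega\to\ell^\infty([0,1]\times\mathcal F)$, the space of bounded real functions on $[0,1]\times\mathcal F$ with the supremum norm and its Borel $\sigma$-field. For $1\le i\le j\le n$ put $S_{n,i,j}(f)=\sum_{k=i}^j\bigl(f(X_{k,n})-\mathrm E f(X_{k,n})\bigr)$. For a map $Y$ on $\Omega$ with values in $\overline{\mathbb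 R}$, $\mathrm E^*\{Y\}=\inf\{\mathrm E U: U\ge Y,\ U:\Omega\to\overline{\mathbb R}\text{ measurable},\ \mathrm E U\text{ exists}\}$, and $P^*(A)=\inf\{P(A'):A\subseteq A'\in\Upsilon\}$ for $A\subseteq\Omega$. For $\alpha>1$, a function $g:\mathbb N\to\mathbb R$ and $Q\in[1,2^{(\alpha-1)/\alpha})$, the pair $(\alpha,g)$ *fulfills condition (S) with index $Q$* if $g\ge0$, $g$ is nondecreasing, and $g(i)+g(j-i)\le Q\,g(j)$ for all $1\le i<j$. **Theorem.** Let $\nu>2$, let $\rho$ be a semimetric on $\mathcal F$ (nonnegative, symmetric, $\rho(f,f)=0$, triangle inequality), and put $\mathcal F_\delta=\{f-g: f,g\in\mathcal F,\ \rho(f,g)\le\delta\}$ for $\delta>0$. Assume: 1. There are $g:\mathbb N\times(0,\infty)\to\mathbb R$ and $Q_g\in[1,2^{1-2/\nu})$, not depending on $\delta$, such that for each $\delta>0$ the pair $(\nu/2,g(\cdot,\delta))$ fulfills condition (S) with index $Q_g$, and for all $n\in\mathbb N$, $\delta>0$ and $1\le i\le j\le n$, $$\mathrm E^*\Bigl\{\sup_{f\in\mathcal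 F_\delta}|S_{n,i,j}(f)|^\nu\Bigr\}\le g(j-i+1,\delta)^{\nu/2}.$$ 2. There are $h:\mathbb N\to\mathbb R$ and $Q_h\in[1,2^{1-2/\nu})$ such that $(\nu/2,h)$ fulfills condition (S) with index $Q_h$, and for all $n\in\mathbb N$ and $1\le i\le j\le n$, $$\mathrm E^*\Bigl\{\sup_{f\in\mathcal F}|S_{n,i,j}(f)|^\nu\Bigr\}\le h(j-i+1)^{\nu/2}.$$ 3. $\displaystyle\lim_{\delta\downarrow0}\limsup_{n\to\infty}\frac{g(n,\delta)}{n}=0.$ 4. There is a constant $C\ge0$ such that $\displaystyle\limsup_{n\to\infty}\frac{h(\lfloor n\varepsilon\rfloor)}{n}\le C\varepsilon$ for each $0<\varepsilon\le1$ (with the convention $h(0)=0$). Then, with $\tau((s,f),(t,g))=|s-t|+\rho(f,g)$, the process $\mathbb Z_n$ is asymptotically uniformly equicontinuous in probability: for every $\varepsilon>0$, $$\lim_{\delta\downarrow0}\limsup_{n\to\infty}P^*\Bigl(\sup_{\tau((s,f),(t,g))\le\delta}|\mathbb Z_n(s,f)-\mathbb Z_n(t,g)|>\varepsilon\Bigr)=0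 .$$ If, in addition, $(\mathcal F,\rho)$ is totally bounded, then fidi-convergence of $\mathbb Z_n$ implies weak convergence in $\ell^\infty([0,1]\times\mathcal F)$. That is: suppose that for every finite $I\subseteq[0,1]\times\mathcal F$ the random vectors $(\mathbb Z_n(\psi))_{\psi\in I}$ converge in distribution to some law $m_I$ on $\mathbb R^I$. Then there is a tight Borel probability measure $L$ on $\ell^\infty([0,1]\times\mathcal F)$ with finite-dimensional marginals $m_I$ such that $\mathrm E^*\{\varphi(\mathbb Z_n)\}\to\int\varphi\,dL$ for all bounded continuous $\varphi:\ell^\infty([0,1]\times\mathcal F)\to\mathbb R$, and this convergence holds for every tight Borel probability measure $L$ on $\ell^\infty([0,1]\times\mathcal F)$ with these marginals. -/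

import Mathlib

open MeasureTheory Filter Topology
open scoped ENNReal BoundedContinuousFunction

noncomputable section

namespace SeqEmp

/-! ### Outer expectation -/

section Outer

variable {Ω : Type*} [MeasurableSpace Ω]

/-- The expectation of an extended-real-valued map exists if its positive or its negative part
has a finite integral. -/
def ExpectationExists (P : Measure Ω) (U : Ω → EReal) : Prop :=
  ∫⁻ ω, (U ω).toENNReal ∂P ≠ ⊤ ∨ ∫⁻ ω, (-U ω).toENNReal ∂P ≠ ⊤

/-- The expectation of an extended-real-valued map, as integral of the positive part minus
integral of the negative part (only used for measurable maps with `ExpectationExists`). -/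
def expectation (P : Measure Ω) (U : Ω → EReal) : EReal :=
  ((∫⁻ ω, (U ω).toENNReal ∂P : ℝ≥0∞) : EReal) - ((∫⁻ ω, (-U ω).toENNReal ∂P : ℝ≥0∞) : EReal)

/-- The outer expectation of a possibly nonmeasurable map: the infimum of `E U` over the
measurable `U ≥ Y` whose expectation exists. -/
def outerExpectation (P : Measure Ω) (Y : Ω → EReal) : EReal :=
  sInf {e : EReal | ∃ U : Ω → EReal,
    Measurable U ∧ (∀ ω, Y ω ≤ U ω) ∧ ExpectationExists P U ∧ e = expectation P U}

end Outer

/-! ### Semimetrics -/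

/-- A semimetric: like a metric, but distinct points may have distance zero. -/
structure IsSemimetric {S : Type*} (ρ : S → S → ℝ) : Prop where
  nonneg : ∀ x y, 0 ≤ ρ x y
  self : ∀ x, ρ x x = 0
  symm : ∀ x y, ρ x y = ρ y x
  triangle : ∀ x y z, ρ x z ≤ ρ x y + ρ y z

/-- Total boundedness of a semimetric space: finitely many `ε`-balls cover it, for all `ε > 0`. -/
def IsTotallyBounded {S : Type*} (ρ : S → S → ℝ) : Prop :=
  ∀ ε : ℝ, 0 < ε → ∃ A : Finset S, ∀ x, ∃ a ∈ A, ρ x a < ε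

/-! ### The growth condition (S) -/

/-- The pair `(α, g)` fulfills condition (S) with index `Q ∈ [1, 2 ^ ((α - 1) / α))`. The domain of
`g` is the set of positive integers, so `g 0` is left unconstrained. -/
structure ConditionS (α Q : ℝ) (g : ℕ → ℝ) : Prop where
  one_le : 1 ≤ Q
  lt : Q < (2 : ℝ) ^ ((α - 1) / α)
  nonneg : ∀ m, 1 ≤ m → 0 ≤ g m
  mono : ∀ i j, 1 ≤ i → i ≤ j → g i ≤ g j
  add_le : ∀ i j, 1 ≤ i → i < j → g i + g (j - i) ≤ Q * g j

/-! ### The space `ℓ^∞(Ψ)` and weak convergence in it -/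

/-- Bounded real functions on `Ψ` with the supremum norm. -/
abbrev LInf (Ψ : Type*) := lp (fun _ : Ψ => ℝ) ∞

/-- `ℓ^∞(Ψ)` carries the Borel σ-field of the supremum norm. -/
instance instMeasurableSpaceLInf (Ψ : Type*) : MeasurableSpace (LInf Ψ) := borel _

instance instBorelSpaceLInf (Ψ : Type*) : BorelSpace (LInf Ψ) := ⟨rfl⟩

section Weak

variable {Ω : Type*} [MeasurableSpace Ω] {Ψ : Type*}

/-- Weak convergence (in the sense of Hoffmann-Jørgensen) of arbitrary maps `Z n : Ω → ℓ^∞(Ψ)` to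
a random element of `ℓ^∞(Ψ)` with Borel law `L`: `E^* h(Z n) → ∫ h dL` for all bounded
continuous `h`. -/
def WeaklyConverges (P : Measure Ω) (Z : ℕ → Ω → LInf Ψ) (L : ProbabilityMeasure (LInf Ψ)) :
    Prop :=
  ∀ h : LInf Ψ →ᵇ ℝ,
    Tendsto (fun n => outerExpectation P (fun ω => ((h (Z n ω) : ℝ) : EReal))) atTop
      (𝓝 ((∫ z, h z ∂(L : Measure (LInf Ψ)) : ℝ) : EReal))

/-- Convergence of the finite-dimensional distributions of `Z n` to the laws `m I`: for each finite
`I ⊆ Ψ`, the random vectors `(Z n ψ)_{ψ ∈ I}` converge in distribution to `m I`. -/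
def FidiConverges (P : Measure Ω) (Z : ℕ → Ω → Ψ → ℝ)
    (m : (I : Finset Ψ) → ProbabilityMeasure (I → ℝ)) : Prop :=
  ∀ (I : Finset Ψ) (φ : (I → ℝ) →ᵇ ℝ),
    Tendsto (fun n => ∫ ω, φ (fun ψ : I => Z n ω ψ) ∂P) atTop
      (𝓝 (∫ x, φ x ∂(m I : Measure (I → ℝ))))

/-- The Borel law `L` on `ℓ^∞(Ψ)` has the finite-dimensional marginals `m I`. -/
def HasMarginals (L : ProbabilityMeasure (LInf Ψ))
    (m : (I : Finset Ψ) → ProbabilityMeasure (I → ℝ)) : Prop :=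
  ∀ I : Finset Ψ,
    (L : Measure (LInf Ψ)).map (fun (z : LInf Ψ) (ψ : I) => z ψ) = (m I : Measure (I → ℝ))

/-- Asymptotic uniform equicontinuity in probability with respect to `τ`. A measure in Mathlib,
applied to an arbitrary set, is the infimum of its values on measurable supersets, hence `P` below
is the outer probability. -/
def AEC (P : Measure Ω) (Z : ℕ → Ω → Ψ → ℝ) (τ : Ψ → Ψ → ℝ) : Prop :=
  ∀ ε : ℝ, 0 < ε →
    Tendsto
      (fun δ : ℝ => limsup
        (fun n : ℕ => P {ω | ENNReal.ofReal ε <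
          ⨆ (p : Ψ) (q : Ψ) (_ : τ p q ≤ δ), ENNReal.ofReal |Z n ω p - Z n ω q|}) atTop)
      (𝓝[>] 0) (𝓝 0)

end Weak

/-! ### The sequential empirical process

An array is a map `X` with `X n i` in the role of `X_{i,n}`; only `1 ≤ i ≤ n` matters. -/

section EmpProc

variable {Ω : Type*} [MeasurableSpace Ω] {𝒳 : Type*} [MeasurableSpace 𝒳]

/-- A measurable, finite, integrable envelope of the class `F`. -/
def HasEnvelope (P : Measure Ω) (X : ℕ → ℕ → Ω → 𝒳) (F : Set (𝒳 → ℝ)) : Prop :=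
  ∃ B : 𝒳 → ℝ, Measurable B ∧ (∀ f ∈ F, ∀ x, |f x| ≤ B x) ∧
    ∀ n i, 1 ≤ i → i ≤ n → Integrable (fun ω => B (X n i ω)) P

/-- The sum over `k = i, …, j` of the centered variables `f(X_{k,n}) - E f(X_{k,n})`. -/
def centeredSum (P : Measure Ω) (X : ℕ → ℕ → Ω → 𝒳) (n i j : ℕ) (f : 𝒳 → ℝ) (ω : Ω) : ℝ :=
  ∑ k ∈ Finset.Icc i j, (f (X n k ω) - ∫ ω', f (X n k ω') ∂P)

/-- The supremum over `f ∈ G` of the `ν`-th absolute powers of the centered sums. -/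
def supCenteredSum (P : Measure Ω) (X : ℕ → ℕ → Ω → 𝒳) (G : Set (𝒳 → ℝ)) (ν : ℝ) (n i j : ℕ)
    (ω : Ω) : ℝ≥0∞ :=
  ⨆ f ∈ G, ENNReal.ofReal (|centeredSum P X n i j f ω| ^ ν)

/-- The class `F_δ` of differences `f - g` with `f, g ∈ F` and `ρ(f, g) ≤ δ`. -/
def diffClass {F : Set (𝒳 → ℝ)} (ρ : F → F → ℝ) (δ : ℝ) : Set (𝒳 → ℝ) :=
  {d | ∃ f g : F, ρ f g ≤ δ ∧ d = (f : 𝒳 → ℝ) - (g : 𝒳 → ℝ)}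

/-- The index set `[0,1] × F`. -/
abbrev Idx (F : Set (𝒳 → ℝ)) := Set.Icc (0 : ℝ) 1 × F

/-- `τ((s,f),(t,g)) = |s - t| + ρ(f,g)`. -/
def tau {F : Set (𝒳 → ℝ)} (ρ : F → F → ℝ) (p q : Idx F) : ℝ :=
  |(p.1 : ℝ) - (q.1 : ℝ)| + ρ p.2 q.2

/-- The sequential empirical process, as a real function on `[0,1] × F` for each `ω`. -/
def process (P : Measure Ω) (X : ℕ → ℕ → Ω → 𝒳) (F : Set (𝒳 → ℝ)) (n : ℕ) (ω : Ω)
    (p : Idx F) : ℝ :=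
  1 / Real.sqrt n * centeredSum P X n 1 ⌊(n : ℝ) * (p.1 : ℝ)⌋₊ (p.2 : 𝒳 → ℝ) ω

theorem process_memℓp {P : Measure Ω} {X : ℕ → ℕ → Ω → 𝒳} {F : Set (𝒳 → ℝ)}
    (hF : HasEnvelope P X F) (n : ℕ) (ω : Ω) :
    Memℓp (fun p : Idx F => process P X F n ω p) ∞ := by
  obtain ⟨B, -, hB, hint⟩ := hF
  refine memℓp_infty ⟨1 / Real.sqrt n *
    ∑ k ∈ Finset.Icc 1 n, (B (X n k ω) + ∫ ω', B (X n k ω') ∂P), ?_⟩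
  rintro _ ⟨p, rfl⟩
  have hfl : ⌊(n : ℝ) * (p.1 : ℝ)⌋₊ ≤ n := by
    have h1 : (n : ℝ) * (p.1 : ℝ) ≤ n :=
      mul_le_of_le_one_right (Nat.cast_nonneg n) p.1.2.2
    simpa using Nat.floor_le_floor h1
  have hB0 : ∀ x, 0 ≤ B x := fun x => (abs_nonneg _).trans (hB p.2 p.2.2 x)
  have hterm : ∀ k ∈ Finset.Icc 1 n,
      |(p.2 : 𝒳 → ℝ) (X n k ω) - ∫ ω', (p.2 : 𝒳 → ℝ) (X n k ω') ∂P| ≤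
        B (X n k ω) + ∫ ω', B (X n k ω') ∂P := by
    intro k hk
    rw [Finset.mem_Icc] at hk
    have h2 : |∫ ω', (p.2 : 𝒳 → ℝ) (X n k ω') ∂P| ≤ ∫ ω', B (X n k ω') ∂P := by
      rw [← Real.norm_eq_abs]
      exact norm_integral_le_of_norm_le (hint n k hk.1 hk.2)
        (Filter.Eventually.of_forall fun ω' => hB p.2 p.2.2 (X n k ω'))
    exact (abs_sub _ _).trans (add_le_add (hB p.2 p.2.2 _) h2)
  change ‖process P X F n ω p‖ ≤ _
  rw [Real.norm_eq_abs, process, abs_mul, abs_of_nonneg (by positivity)]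
  refine mul_le_mul_of_nonneg_left ?_ (by positivity)
  have hsub : Finset.Icc 1 ⌊(n : ℝ) * (p.1 : ℝ)⌋₊ ⊆ Finset.Icc 1 n :=
    Finset.Icc_subset_Icc le_rfl hfl
  refine (Finset.abs_sum_le_sum_abs _ _).trans
    ((Finset.sum_le_sum fun k hk => hterm k (hsub hk)).trans ?_)
  refine Finset.sum_le_sum_of_subset_of_nonneg hsub fun k _ _ => ?_
  exact add_nonneg (hB0 _) (integral_nonneg fun _ => hB0 _)

/-- The sequential empirical process as a map `Ω → ℓ^∞([0,1] × F)`. -/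
def processLInf {P : Measure Ω} {X : ℕ → ℕ → Ω → 𝒳} {F : Set (𝒳 → ℝ)}
    (hF : HasEnvelope P X F) (n : ℕ) (ω : Ω) : LInf (Idx F) :=
  ⟨fun p => process P X F n ω p, process_memℓp hF n ω⟩

end EmpProc

end SeqEmp

end

namespace SeqEmp

/-! ### Measurable majorants and the dyadic maximal inequality -/

section MeasurableMajorants

variable {Ω : Type*} [MeasurableSpace Ω]

/-! Equicontinuity rests on a maximal inequality of Móricz type. Condition (S) and monotonicity give
`g (m / 2) ≤ Q / 2 * g m`, so bisecting a block shrinks the `L^ν` bound `√(g m)` by `√(Q / 2)`,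
while combining the maxima over the two halves costs `2 ^ (1 / ν)`. The range allowed for `Q` makes
the product less than one, and the recursion closes at the order of a single block sum
(`exists_maximal_majorant`, `maximal_tail_bound`). An increment of the process splits into a change
of function at fixed time and a change of time at fixed function. The first is a maximum over
`diffClass`, with tail of order `(g n δ / n) ^ (ν / 2)`. The second involves about `1 / δ` blocks of
length about `n * δ`, with total tail of order `δ ^ (ν / 2 - 1)`, which vanishes because `ν > 2`
(`increment_subset`, `aec_process`).

For weak convergence, the portmanteau theorem passes the small oscillations to the limit laws,
uniformly over finite index sets. For a Kolmogorov extension of these laws, Borel–Cantelli along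
finite nets makes step-function approximations converge uniformly almost surely, and the law of the
limit is tight with the prescribed marginals (`exists_tight_hasMarginals`). Any tight law with these
marginals has the same small oscillations. Off a small event, both process and limit are thus
uniformly close to step functions of finitely many coordinates, where fidi-convergence applies.
Lipschitz majorants make this closeness usable for every bounded continuous test function
(`exists_integral_majorant`), and passing to `-φ` gives the lower bound. -/

/-- The infimum defining the outer expectation need not be attained a priori, but the pointwise
infimum of countably many near-optimal majorants is again a measurable majorant. -/
theorem exists_measurable_majorant (P : Measure Ω) (Y : Ω → ℝ≥0∞) {r : ℝ}
    (h : outerExpectation P (fun ω => (Y ω : EReal)) ≤ (r : EReal)) :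
    ∃ U : Ω → ℝ≥0∞, Measurable U ∧ (∀ ω, Y ω ≤ U ω) ∧ ∫⁻ ω, U ω ∂P ≤ ENNReal.ofReal r := by
  have key : ∀ k : ℕ, ∃ V : Ω → ℝ≥0∞, Measurable V ∧ (∀ ω, Y ω ≤ V ω) ∧
      ∫⁻ ω, V ω ∂P ≤ ENNReal.ofReal (r + 1 / ((k : ℝ) + 1)) := by
    intro k
    have hlt : (r : EReal) < ((r + 1 / ((k : ℝ) + 1) : ℝ) : EReal) := by
      rw [EReal.coe_lt_coe_iff]
      have : (0 : ℝ) < 1 / ((k : ℝ) + 1) := by positivity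
      linarith
    obtain ⟨e, ⟨U, hU, hYU, -, rfl⟩, he⟩ := sInf_lt_iff.1 (h.trans_lt hlt)
    refine ⟨fun ω => (U ω).toENNReal, hU.ereal_toENNReal, fun ω => ?_, ?_⟩
    · have := EReal.toENNReal_le_toENNReal (hYU ω)
      simpa using this
    -- A majorant of a nonnegative map is nonnegative, so its expectation is a plain lower Lebesgue
    -- integral.
    · have hneg : ∀ ω, (-U ω).toENNReal = 0 := fun ω => by
        apply EReal.toENNReal_of_nonpos
        rw [EReal.neg_le]
        simpa using (EReal.coe_ennreal_nonneg (Y ω)).trans (hYU ω)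
      have h2 : ((∫⁻ ω, (U ω).toENNReal ∂P : ℝ≥0∞) : EReal) ≤
          ((r + 1 / ((k : ℝ) + 1) : ℝ) : EReal) := by
        simpa [expectation, hneg] using he.le
      have h3 := EReal.toENNReal_le_toENNReal h2
      simpa only [EReal.toENNReal_coe, EReal.toENNReal_of_ne_top, EReal.coe_ne_top, ne_eq,
        not_false_eq_true, EReal.toReal_coe] using h3
  choose V hV hYV hint using key
  refine ⟨fun ω => ⨅ k, V k ω, .iInf hV, fun ω => le_iInf fun k => hYV k ω, ?_⟩
  have hlim : Tendsto (fun k : ℕ => ENNReal.ofReal (r + 1 / ((k : ℝ) + 1))) atTop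
      (𝓝 (ENNReal.ofReal (r + 0))) :=
    ENNReal.tendsto_ofReal (tendsto_const_nhds.add tendsto_one_div_add_atTop_nhds_zero_nat)
  rw [add_zero] at hlim
  exact ge_of_tendsto hlim (Eventually.of_forall fun k =>
    (lintegral_mono fun ω => iInf_le _ k).trans (hint k))

/-- Maximal inequality of Móricz type: bounds of order `√(G l)` for the `L^ν` norms of the sums over
blocks of length `l` give bounds of the same order for the maxima of the partial sums. -/
theorem exists_maximal_majorant (P : Measure Ω) {ι : Type*} {ν q A : ℝ} (hν : 1 ≤ ν) (hq : 0 ≤ q)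
    (hA : 0 ≤ A) (hAq : 1 + A * (Real.sqrt q * 2 ^ (1 / ν)) ≤ A)
    {G : ℕ → ℝ} (hG0 : G 0 = 0) (hGm : Monotone G) (hGq : ∀ m, G (m / 2) ≤ q * G m)
    {N : ℕ} (D : ι → Ω → ℕ → ℝ) (V : ℕ → ℕ → Ω → ℝ≥0∞)
    (hV : ∀ i l, 1 ≤ i → 1 ≤ l → i + l ≤ N + 1 → Measurable (V i l))
    (hDV : ∀ i l, 1 ≤ i → 1 ≤ l → i + l ≤ N + 1 → ∀ f ω,
      ENNReal.ofReal |∑ k ∈ Finset.Ico i (i + l), D f ω k| ≤ V i l ω)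
    (hVG : ∀ i l, 1 ≤ i → 1 ≤ l → i + l ≤ N + 1 →
      (∫⁻ ω, V i l ω ^ ν ∂P) ^ (1 / ν) ≤ ENNReal.ofReal (Real.sqrt (G l))) (m : ℕ) :
    ∀ i, 1 ≤ i → i + m ≤ N + 1 → ∃ W : Ω → ℝ≥0∞, Measurable W ∧
      (∀ l ≤ m, ∀ f ω, ENNReal.ofReal |∑ k ∈ Finset.Ico i (i + l), D f ω k| ≤ W ω) ∧
      (∫⁻ ω, W ω ^ ν ∂P) ^ (1 / ν) ≤ ENNReal.ofReal (A * Real.sqrt (G m)) := by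
  have hν0 : 0 < ν := by linarith
  induction m using Nat.strong_induction_on with
  | _ m ih =>
  intro i hi him
  rcases Nat.eq_zero_or_pos m with rfl | hm
  · refine ⟨fun _ => 0, measurable_const, ?_, ?_⟩
    · intro l hl f ω
      obtain rfl : l = 0 := by omega
      simp
    · simp [ENNReal.zero_rpow_of_pos hν0, hν0]
  -- Cut after `p + 1` terms. Partial sums of length at most `p` are handled by `W₁`; a longer one
  -- is the full sum of the first `p + 1` terms plus a partial sum of the remaining `r ≤ p`, handled
  -- by `W₂`.
  obtain ⟨p, hp⟩ : ∃ p, p = m / 2 := ⟨_, rfl⟩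
  obtain ⟨r, hr⟩ : ∃ r, m = p + 1 + r := ⟨m - p - 1, by omega⟩
  have hrp : r ≤ p := by omega
  have hGm0 : 0 ≤ G m := hG0 ▸ hGm (Nat.zero_le m)
  have hGp : G p ≤ q * G m := hp ▸ hGq m
  obtain ⟨W₁, hW₁, hb₁, hn₁⟩ := ih p (by omega) i hi (by omega)
  obtain ⟨W₂, hW₂, hb₂, hn₂⟩ := ih r (by omega) (i + p + 1) (by omega) (by omega)
  have hVm := hV i (p + 1) hi (by omega) (by omega)
  -- The `ℓ^ν` norm of the pair dominates both entries, and its `ν`-th moment is the sum of theirs;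
  -- hence the factor `2 ^ (1 / ν)`.
  have hmax : Measurable fun ω => (W₁ ω ^ ν + W₂ ω ^ ν) ^ (1 / ν) :=
    ((hW₁.pow_const _).add (hW₂.pow_const _)).pow_const _
  have hle₁ : ∀ ω, W₁ ω ≤ (W₁ ω ^ ν + W₂ ω ^ ν) ^ (1 / ν) := fun ω => by
    rw [one_div, ENNReal.le_rpow_inv_iff hν0]
    exact le_self_add
  have hle₂ : ∀ ω, W₂ ω ≤ (W₁ ω ^ ν + W₂ ω ^ ν) ^ (1 / ν) := fun ω => by
    rw [one_div, ENNReal.le_rpow_inv_iff hν0]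
    exact le_add_self
  refine ⟨fun ω => V i (p + 1) ω + (W₁ ω ^ ν + W₂ ω ^ ν) ^ (1 / ν), hVm.add hmax, ?_, ?_⟩
  · intro l hl f ω
    rcases le_or_gt l p with hlp | hlp
    · exact (hb₁ l hlp f ω).trans ((hle₁ ω).trans le_add_self)
    · obtain ⟨s, rfl⟩ : ∃ s, l = p + 1 + s := ⟨l - p - 1, by omega⟩
      rw [← Finset.sum_Ico_consecutive _ (show i ≤ i + (p + 1) by omega)
        (show i + (p + 1) ≤ i + (p + 1 + s) by omega)]
      refine (ENNReal.ofReal_le_ofReal (abs_add_le _ _)).trans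
        ((ENNReal.ofReal_add_le).trans (add_le_add ?_ ?_))
      · exact hDV i (p + 1) hi (by omega) (by omega) f ω
      · have := hb₂ s (by omega) f ω
        rw [show i + p + 1 + s = i + (p + 1 + s) by ring, show i + p + 1 = i + (p + 1) by ring]
          at this
        exact this.trans (hle₂ ω)
  · have hs : Real.sqrt (G p) ≤ Real.sqrt q * Real.sqrt (G m) := by
      rw [← Real.sqrt_mul hq]
      exact Real.sqrt_le_sqrt hGp
    have hb : ∀ W : Ω → ℝ≥0∞, ∀ s ≤ p,
        (∫⁻ ω, W ω ^ ν ∂P) ^ (1 / ν) ≤ ENNReal.ofReal (A * Real.sqrt (G s)) →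
        ∫⁻ ω, W ω ^ ν ∂P ≤
          ENNReal.ofReal (A * (Real.sqrt q * Real.sqrt (G m))) ^ ν := by
      intro W s hsp hW
      rw [one_div, ENNReal.rpow_inv_le_iff hν0] at hW
      refine hW.trans (ENNReal.rpow_le_rpow (ENNReal.ofReal_le_ofReal ?_) hν0.le)
      exact mul_le_mul_of_nonneg_left ((Real.sqrt_le_sqrt (hGm hsp)).trans hs) hA
    refine (ENNReal.lintegral_Lp_add_le hVm.aemeasurable hmax.aemeasurable hν).trans ?_
    have hsecond : (∫⁻ ω, ((W₁ ω ^ ν + W₂ ω ^ ν) ^ (1 / ν)) ^ ν ∂P) ^ (1 / ν) ≤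
        ENNReal.ofReal (A * (Real.sqrt q * 2 ^ (1 / ν)) * Real.sqrt (G m)) := by
      have heq : ∀ ω, ((W₁ ω ^ ν + W₂ ω ^ ν) ^ (1 / ν)) ^ ν = W₁ ω ^ ν + W₂ ω ^ ν := fun ω => by
        rw [← ENNReal.rpow_mul, one_div_mul_cancel hν0.ne', ENNReal.rpow_one]
      simp_rw [heq]
      rw [lintegral_add_left (hW₁.pow_const _)]
      refine (ENNReal.rpow_le_rpow (add_le_add (hb W₁ p le_rfl hn₁) (hb W₂ r hrp hn₂))
        (by positivity)).trans ?_
      rw [← two_mul, ENNReal.mul_rpow_of_nonneg _ _ (by positivity), ← ENNReal.rpow_mul,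
        mul_one_div_cancel hν0.ne', ENNReal.rpow_one,
        show (2 : ℝ≥0∞) = ENNReal.ofReal 2 by simp,
        ENNReal.ofReal_rpow_of_pos (by norm_num), ← ENNReal.ofReal_mul (by positivity)]
      apply ENNReal.ofReal_le_ofReal
      apply le_of_eq
      ring
    refine (add_le_add (hVG i (p + 1) hi (by omega) (by omega)) hsecond).trans ?_
    rw [← ENNReal.ofReal_add (Real.sqrt_nonneg _) (by positivity)]
    apply ENNReal.ofReal_le_ofReal
    have h1 : Real.sqrt (G (p + 1)) ≤ Real.sqrt (G m) := Real.sqrt_le_sqrt (hGm (by omega))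
    calc _ ≤ (1 + A * (Real.sqrt q * 2 ^ (1 / ν))) * Real.sqrt (G m) := by linarith
      _ ≤ _ := mul_le_mul_of_nonneg_right hAq (Real.sqrt_nonneg _)

end MeasurableMajorants

/-! ### Tail bounds from condition (S), and reduction to blocks -/

section TailBounds

variable {Ω : Type*} [MeasurableSpace Ω] {𝒳 : Type*}

/-- The factor by which halving a block contracts the bound is less than one. -/
theorem sqrt_mul_rpow_lt_one {ν Q : ℝ} (hν : 2 < ν)
    (hQ : Q < (2 : ℝ) ^ ((ν / 2 - 1) / (ν / 2))) :
    Real.sqrt (Q / 2) * 2 ^ (1 / ν) < 1 := by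
  have hν0 : 0 < ν := by linarith
  have h1 : Q / 2 < (2 : ℝ) ^ (-(2 / ν)) := by
    rw [div_lt_iff₀ (by norm_num)]
    calc Q < (2 : ℝ) ^ ((ν / 2 - 1) / (ν / 2)) := hQ
      _ = (2 : ℝ) ^ (-(2 / ν) + 1) := by
        congr 1
        field_simp
        ring
      _ = (2 : ℝ) ^ (-(2 / ν)) * 2 := by
        rw [Real.rpow_add (by norm_num), Real.rpow_one]
  have h2 : Real.sqrt (Q / 2) < (2 : ℝ) ^ (-(1 / ν)) := by
    rw [Real.sqrt_lt' (by positivity)]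
    refine h1.trans_le (le_of_eq ?_)
    rw [← Real.rpow_natCast, ← Real.rpow_mul (by norm_num)]
    congr 1
    push_cast
    ring
  calc Real.sqrt (Q / 2) * 2 ^ (1 / ν) < (2 : ℝ) ^ (-(1 / ν)) * 2 ^ (1 / ν) :=
        mul_lt_mul_of_pos_right h2 (by positivity)
    _ = 1 := by rw [← Real.rpow_add (by norm_num)]; simp

/-- Markov's inequality for the `ν`-th moment of the maximal majorant. The constant depends on `ν`
and `Q` alone, so it is uniform in `n` and in the class, hence in `δ`. -/
theorem maximal_tail_bound {ν Q : ℝ} (hν : 2 < ν) :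
    ∃ K : ℝ, 0 ≤ K ∧ ∀ (P : Measure Ω) (X : ℕ → ℕ → Ω → 𝒳) (𝒢 : Set (𝒳 → ℝ)) (g : ℕ → ℝ) (n : ℕ),
      ConditionS (ν / 2) Q g →
      (∀ i j : ℕ, 1 ≤ i → i ≤ j → j ≤ n →
        outerExpectation P (fun ω => ((supCenteredSum P X 𝒢 ν n i j ω : ENNReal) : EReal))
          ≤ ((g (j - i + 1) ^ (ν / 2) : ℝ) : EReal)) →
      ∀ (i m : ℕ) (c : ℝ), 1 ≤ i → 1 ≤ m → i + m ≤ n + 1 → 0 < c →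
        P {ω | ∃ f ∈ 𝒢, ∃ l ≤ m, c < |∑ k ∈ Finset.Ico i (i + l),
          (f (X n k ω) - ∫ ω', f (X n k ω') ∂P)|} ≤
            ENNReal.ofReal (K * (g m / c ^ 2) ^ (ν / 2)) := by
  have hν0 : 0 < ν := by linarith
  obtain ⟨θ, hθ⟩ : ∃ θ, θ = Real.sqrt (Q / 2) * 2 ^ (1 / ν) := ⟨_, rfl⟩
  -- The fixed point of `A = 1 + A * θ`. The maximum with `0` keeps `A` nonnegative before `θ < 1`
  -- is known.
  obtain ⟨A, hA⟩ : ∃ A, A = max 0 (1 / (1 - θ)) := ⟨_, rfl⟩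
  have hA0 : 0 ≤ A := hA ▸ le_max_left _ _
  refine ⟨A ^ ν, by positivity, fun P X 𝒢 g n hS hg i m c hi hm him hc => ?_⟩
  have hθ1 : θ < 1 := hθ ▸ sqrt_mul_rpow_lt_one hν hS.lt
  have hAθ : 1 + A * θ ≤ A := by
    have : A = 1 / (1 - θ) := hA.trans (max_eq_right (by
      have := sub_pos.2 hθ1
      positivity))
    have h1 : A * (1 - θ) = 1 := by
      rw [this]
      exact one_div_mul_cancel (sub_pos.2 hθ1).ne'
    linarith
  -- Condition (S) says nothing about `g 0`, whereas the recursion reaches empty blocks.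
  obtain ⟨G, hG⟩ : ∃ G : ℕ → ℝ, G = fun m => if m = 0 then 0 else g m := ⟨_, rfl⟩
  have hGpos : ∀ m, 1 ≤ m → G m = g m := fun m hm => by
    rw [hG]
    exact if_neg (by omega)
  have hG0 : G 0 = 0 := by rw [hG]; simp
  have hGm : Monotone G := by
    intro a b hab
    rcases Nat.eq_zero_or_pos a with rfl | ha
    · rcases Nat.eq_zero_or_pos b with rfl | hb
      · exact le_rfl
      · rw [hG0, hGpos b hb]
        exact hS.nonneg b hb
    · rw [hGpos a ha, hGpos b (le_trans ha hab)]
      exact hS.mono a b ha hab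
  have hGq : ∀ m, G (m / 2) ≤ Q / 2 * G m := by
    intro m
    rcases Nat.lt_or_ge m 2 with h | h
    · rw [show m / 2 = 0 by omega, hG0]
      have h1 : 0 ≤ G m := hG0 ▸ hGm (Nat.zero_le m)
      have h2 := hS.one_le
      positivity
    · rw [hGpos _ (by omega), hGpos m (by omega)]
      -- By monotonicity the shorter half may be counted twice on the left.
      have h1 := hS.add_le (m / 2) m (by omega) (by omega)
      have h2 := hS.mono (m / 2) (m - m / 2) (by omega) (by omega)
      linarith
  have hmaj : ∀ i l : ℕ, ∃ U : Ω → ℝ≥0∞, 1 ≤ i → 1 ≤ l → i + l ≤ n + 1 →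
      Measurable U ∧ (∀ ω, supCenteredSum P X 𝒢 ν n i (i + l - 1) ω ≤ U ω) ∧
        ∫⁻ ω, U ω ∂P ≤ ENNReal.ofReal (g l ^ (ν / 2)) := by
    intro i l
    by_cases h : 1 ≤ i ∧ 1 ≤ l ∧ i + l ≤ n + 1
    · have h1 := hg i (i + l - 1) h.1 (by omega) (by omega)
      rw [show i + l - 1 - i + 1 = l by omega] at h1
      obtain ⟨U, hU⟩ := exists_measurable_majorant P _ h1
      exact ⟨U, fun _ _ _ => hU⟩
    · exact ⟨0, fun h1 h2 h3 => absurd ⟨h1, h2, h3⟩ h⟩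
  choose U hU using hmaj
  obtain ⟨W, hW, hWb, hWn⟩ := exists_maximal_majorant (ι := 𝒢) P (ν := ν) (q := Q / 2) (A := A)
    (by linarith) (by linarith [hS.one_le]) hA0 (hθ ▸ hAθ) hG0 hGm hGq (N := n)
    (fun f ω k => (f : 𝒳 → ℝ) (X n k ω) - ∫ ω', (f : 𝒳 → ℝ) (X n k ω') ∂P)
    (fun i l ω => U i l ω ^ (1 / ν)) (fun i l h1 h2 h3 => (hU i l h1 h2 h3).1.pow_const _)
    (fun i l h1 h2 h3 f ω => by
      rw [one_div, ENNReal.le_rpow_inv_iff hν0]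
      refine le_trans ?_ ((hU i l h1 h2 h3).2.1 ω)
      rw [ENNReal.ofReal_rpow_of_nonneg (abs_nonneg _) hν0.le]
      have : Finset.Ico i (i + l) = Finset.Icc i (i + l - 1) := by
        ext k
        simp only [Finset.mem_Ico, Finset.mem_Icc]
        omega
      rw [this]
      exact le_iSup₂_of_le (f : 𝒳 → ℝ) f.2 le_rfl)
    (fun i l h1 h2 h3 => by
      have heq : ∀ ω, (U i l ω ^ (1 / ν)) ^ ν = U i l ω := fun ω => by
        rw [← ENNReal.rpow_mul, one_div_mul_cancel hν0.ne', ENNReal.rpow_one]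
      simp_rw [heq]
      refine (ENNReal.rpow_le_rpow (hU i l h1 h2 h3).2.2 (by positivity)).trans ?_
      have hgl := hS.nonneg l h2
      rw [ENNReal.ofReal_rpow_of_nonneg (by positivity) (by positivity), hGpos l h2,
        ← Real.rpow_mul hgl, Real.sqrt_eq_rpow]
      apply le_of_eq
      congr 2
      field_simp)
    m i hi him
  have hc' : ENNReal.ofReal c ^ ν ≠ 0 := by
    simp [ENNReal.rpow_eq_zero_iff, hc]
  have hgm := hS.nonneg m hm
  calc P {ω | ∃ f ∈ 𝒢, ∃ l ≤ m, c < |∑ k ∈ Finset.Ico i (i + l),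
          (f (X n k ω) - ∫ ω', f (X n k ω') ∂P)|}
      ≤ P {ω | ENNReal.ofReal c ^ ν ≤ W ω ^ ν} := by
        refine measure_mono ?_
        rintro ω ⟨f, hf, l, hl, hlt⟩
        exact ENNReal.rpow_le_rpow
          ((ENNReal.ofReal_le_ofReal hlt.le).trans (hWb l hl ⟨f, hf⟩ ω)) hν0.le
    _ ≤ (∫⁻ ω, W ω ^ ν ∂P) / ENNReal.ofReal c ^ ν :=
        meas_ge_le_lintegral_div (hW.pow_const _).aemeasurable hc' (by finiteness)
    _ ≤ ENNReal.ofReal ((A * Real.sqrt (g m)) ^ ν) / ENNReal.ofReal (c ^ ν) := by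
        rw [one_div, ENNReal.rpow_inv_le_iff hν0, hGpos m hm,
          ENNReal.ofReal_rpow_of_nonneg (by positivity) hν0.le] at hWn
        rw [ENNReal.ofReal_rpow_of_pos hc]
        exact ENNReal.div_le_div_right hWn _
    _ = ENNReal.ofReal (A ^ ν * (g m / c ^ 2) ^ (ν / 2)) := by
        rw [← ENNReal.ofReal_div_of_pos (by positivity)]
        congr 1
        rw [Real.mul_rpow hA0 (Real.sqrt_nonneg _), Real.div_rpow hgm (by positivity),
          Real.sqrt_eq_rpow, ← Real.rpow_mul hgm, ← Real.rpow_natCast c 2,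
          ← Real.rpow_mul hc.le, mul_div_assoc]
        congr 3
        · ring
        · push_cast
          ring

/-- Increments of `u` over distances at most `b` are controlled by increments that start at
multiples of `b`. -/
theorem exists_block_increment {u : ℕ → ℝ} {a c b n : ℕ} {x : ℝ} (hb : 1 ≤ b)
    (hac : a ≤ c) (hcn : c ≤ n) (hcb : c ≤ a + b) (hx : 3 * x < |u c - u a|) :
    ∃ q l, q * b + l ≤ n ∧ l ≤ b ∧ x < |u (q * b + l) - u (q * b)| := by
  by_contra! H
  have hdiv := Nat.div_add_mod a b
  have hmod := Nat.mod_lt a hb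
  have hqa : a / b * b + a % b = a := by rw [mul_comm]; exact hdiv
  have h1 := H (a / b) (a % b) (by omega) hmod.le
  rw [hqa] at h1
  have hx0 : 0 ≤ x := (abs_nonneg _).trans h1
  -- Up to the next multiple of `b`, two increments from the same base point suffice; beyond it,
  -- that multiple is an intermediate point and three are needed.
  rcases le_or_gt c (a / b * b + b) with hc | hc
  · have h2 := H (a / b) (c - a / b * b) (by omega) (by omega)
    rw [show a / b * b + (c - a / b * b) = c by omega] at h2
    rw [abs_le] at h1 h2
    rw [lt_abs] at hx
    rcases hx with hx | hx <;> linarith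
  · have h2 := H (a / b) b (by omega) le_rfl
    have e : (a / b + 1) * b = a / b * b + b := by ring
    have h3 := H (a / b + 1) (c - (a / b * b + b)) (by rw [e]; omega) (by omega)
    rw [e, show a / b * b + b + (c - (a / b * b + b)) = c by omega] at h3
    rw [abs_le] at h1 h2 h3
    rw [lt_abs] at hx
    rcases hx with hx | hx <;> linarith

end TailBounds

/-! ### Asymptotic equicontinuity of the sequential empirical process -/

section Equicontinuity

variable {Ω : Type*} [MeasurableSpace Ω] {𝒳 : Type*}

theorem centeredSum_sub {P : Measure Ω} {X : ℕ → ℕ → Ω → 𝒳} {f g : 𝒳 → ℝ} {n j : ℕ}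
    (hf : ∀ i, 1 ≤ i → i ≤ n → Integrable (fun ω => f (X n i ω)) P)
    (hg : ∀ i, 1 ≤ i → i ≤ n → Integrable (fun ω => g (X n i ω)) P) (hj : j ≤ n) (ω : Ω) :
    centeredSum P X n 1 j f ω - centeredSum P X n 1 j g ω = centeredSum P X n 1 j (f - g) ω := by
  unfold centeredSum
  rw [← Finset.sum_sub_distrib]
  refine Finset.sum_congr rfl fun k hk => ?_
  rw [Finset.mem_Icc] at hk
  simp only [Pi.sub_apply]
  rw [integral_sub (hf k hk.1 (hk.2.trans hj)) (hg k hk.1 (hk.2.trans hj))]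
  ring

theorem centeredSum_eq_sum_Ico (P : Measure Ω) (X : ℕ → ℕ → Ω → 𝒳) (n j : ℕ) (f : 𝒳 → ℝ) (ω : Ω) :
    centeredSum P X n 1 j f ω =
      ∑ k ∈ Finset.Ico 1 (1 + j), (f (X n k ω) - ∫ ω', f (X n k ω') ∂P) := by
  unfold centeredSum
  congr 1
  ext k
  simp only [Finset.mem_Ico, Finset.mem_Icc]
  omega

variable [MeasurableSpace 𝒳]

theorem HasEnvelope.integrable {P : Measure Ω} {X : ℕ → ℕ → Ω → 𝒳} {F : Set (𝒳 → ℝ)}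
    (hEnv : HasEnvelope P X F) (hX : ∀ n i, 1 ≤ i → i ≤ n → Measurable (X n i))
    (hF : ∀ f ∈ F, Measurable f) {f : 𝒳 → ℝ} (hf : f ∈ F) {n i : ℕ} (h1 : 1 ≤ i) (h2 : i ≤ n) :
    Integrable (fun ω => f (X n i ω)) P := by
  obtain ⟨B, -, hB, hint⟩ := hEnv
  exact (hint n i h1 h2).mono' ((hF f hf).comp (hX n i h1 h2)).aestronglyMeasurable
    (Eventually.of_forall fun ω => hB f hf _)

theorem floor_mul_le_of_mem_Icc (n : ℕ) (t : Set.Icc (0 : ℝ) 1) : ⌊(n : ℝ) * (t : ℝ)⌋₊ ≤ n := by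
  have h1 : (n : ℝ) * (t : ℝ) ≤ n := mul_le_of_le_one_right (Nat.cast_nonneg n) t.2.2
  simpa using Nat.floor_le_floor h1

/-- The event that some centered sum over a block starting at `i` of length at most `m` is large. -/
def exceedance (P : Measure Ω) (X : ℕ → ℕ → Ω → 𝒳) (𝒢 : Set (𝒳 → ℝ)) (n i m : ℕ) (c : ℝ) : Set Ω :=
  {ω | ∃ f ∈ 𝒢, ∃ l ≤ m, c < |∑ k ∈ Finset.Ico i (i + l), (f (X n k ω) - ∫ ω', f (X n k ω') ∂P)|}

/-- A large increment of the process forces a large block sum, either over the class of differences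
or over the class itself. -/
theorem increment_subset {P : Measure Ω} {X : ℕ → ℕ → Ω → 𝒳} {F : Set (𝒳 → ℝ)}
    (hX : ∀ n i, 1 ≤ i → i ≤ n → Measurable (X n i)) (hF : ∀ f ∈ F, Measurable f)
    (hEnv : HasEnvelope P X F) {ρ : F → F → ℝ} (hρ : IsSemimetric ρ) {ε δ : ℝ}
    (hδ : 0 < δ) {n : ℕ} (hn : 1 ≤ n) :
    {ω | ENNReal.ofReal ε < ⨆ (p : Idx F) (q : Idx F) (_ : tau ρ p q ≤ δ),
      ENNReal.ofReal |process P X F n ω p - process P X F n ω q|} ⊆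
    exceedance P X (diffClass ρ δ) n 1 n (ε / 2 * Real.sqrt n) ∪
      ⋃ q ∈ Finset.range (⌊1 / δ⌋₊ + 1), exceedance P X F n (q * (⌊n * δ⌋₊ + 1) + 1)
        (min (⌊n * δ⌋₊ + 1) (n - q * (⌊n * δ⌋₊ + 1))) (ε / 6 * Real.sqrt n) := by
  intro ω hω
  simp only [Set.mem_ofPred_eq, lt_iSup_iff] at hω
  obtain ⟨⟨s, f⟩, ⟨t, g⟩, hτ, hlt⟩ := hω
  have hlt' : ε < |process P X F n ω (s, f) - process P X F n ω (t, g)| :=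
    ((ENNReal.ofReal_lt_ofReal_iff').1 hlt).1
  have hρ' : ρ f g ≤ δ := (le_add_of_nonneg_left (abs_nonneg _)).trans hτ
  have hst : |(s : ℝ) - t| ≤ δ := (le_add_of_nonneg_right (hρ.nonneg f g)).trans hτ
  have hn0 : (0 : ℝ) < Real.sqrt n := Real.sqrt_pos.2 (by exact_mod_cast hn)
  have hscale : ∀ x y : ℝ, ∀ c, c < |1 / Real.sqrt n * x - 1 / Real.sqrt n * y| →
      c * Real.sqrt n < |x - y| := by
    intro x y c h
    rw [← mul_sub, abs_mul, abs_of_pos (by positivity), one_div_mul_eq_div,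
      lt_div_iff₀ hn0] at h
    exact h
  have hsplit : ε / 2 < |process P X F n ω (s, f) - process P X F n ω (s, g)| ∨
      ε / 2 < |process P X F n ω (s, g) - process P X F n ω (t, g)| := by
    by_contra! H
    have := abs_sub_le (process P X F n ω (s, f)) (process P X F n ω (s, g))
      (process P X F n ω (t, g))
    linarith
  rcases hsplit with h | h
  · left
    have h1 := hscale _ _ _ h
    refine ⟨(f : 𝒳 → ℝ) - (g : 𝒳 → ℝ), ⟨f, g, hρ', rfl⟩, _, floor_mul_le_of_mem_Icc n s, ?_⟩
    rw [← centeredSum_eq_sum_Ico]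
    rw [centeredSum_sub (fun i a b => hEnv.integrable hX hF f.2 a b)
      (fun i a b => hEnv.integrable hX hF g.2 a b) (floor_mul_le_of_mem_Icc n s)] at h1
    exact h1
  · right
    have h1 : ε / 2 * Real.sqrt n < |centeredSum P X n 1 ⌊(n : ℝ) * (s : ℝ)⌋₊ g ω -
        centeredSum P X n 1 ⌊(n : ℝ) * (t : ℝ)⌋₊ g ω| := hscale _ _ _ h
    -- The added one makes `b` exceed `n * δ`: times within `δ` have floors within `b`, and at most
    -- `1 / δ` multiples of `b` after zero fit below `n`.
    obtain ⟨b, hb⟩ : ∃ b, b = ⌊(n : ℝ) * δ⌋₊ + 1 := ⟨_, rfl⟩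
    rw [← hb]
    have hnδ : (n : ℝ) * δ < b := by
      rw [hb]
      exact_mod_cast Nat.lt_floor_add_one ((n : ℝ) * δ)
    have hfloor : ∀ x y : Set.Icc (0 : ℝ) 1, (y : ℝ) - x ≤ δ →
        ⌊(n : ℝ) * (y : ℝ)⌋₊ ≤ ⌊(n : ℝ) * (x : ℝ)⌋₊ + b := by
      intro x y hxy
      have h2 : (n : ℝ) * y < (⌊(n : ℝ) * (x : ℝ)⌋₊ : ℝ) + 1 + (b : ℝ) := by
        have h3 := Nat.lt_floor_add_one ((n : ℝ) * (x : ℝ))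
        have h4 : (n : ℝ) * y ≤ n * x + n * δ := by
          rw [← mul_add]
          exact mul_le_mul_of_nonneg_left (by linarith) (Nat.cast_nonneg n)
        linarith
      have h5 : ⌊(n : ℝ) * (y : ℝ)⌋₊ < ⌊(n : ℝ) * (x : ℝ)⌋₊ + 1 + b := by
        rw [Nat.floor_lt (mul_nonneg (Nat.cast_nonneg n) y.2.1)]
        exact_mod_cast h2
      omega
    rw [abs_le] at hst
    have key : ∃ q l, q * b + l ≤ n ∧ l ≤ b ∧ ε / 6 * Real.sqrt n <
        |centeredSum P X n 1 (q * b + l) g ω - centeredSum P X n 1 (q * b) g ω| := by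
      rcases le_total ⌊(n : ℝ) * (s : ℝ)⌋₊ ⌊(n : ℝ) * (t : ℝ)⌋₊ with hle | hle
      · refine exists_block_increment (u := fun j => centeredSum P X n 1 j g ω) (by omega) hle
          (floor_mul_le_of_mem_Icc n t) (hfloor s t (by linarith)) ?_
        rw [abs_sub_comm]
        linarith
      · refine exists_block_increment (u := fun j => centeredSum P X n 1 j g ω) (by omega) hle
          (floor_mul_le_of_mem_Icc n s) (hfloor t s (by linarith)) ?_
        linarith
    obtain ⟨q, l, hql, hlb, hx⟩ := key
    simp only [Set.mem_iUnion]
    refine ⟨q, ?_, g, g.2, l, le_min hlb (by omega), ?_⟩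
    · rw [Finset.mem_range, Nat.lt_succ_iff]
      apply Nat.le_floor
      rw [le_div_iff₀ hδ]
      have h6 : (q : ℝ) * b ≤ n := by exact_mod_cast (show q * b ≤ n by omega)
      have h7 : (q : ℝ) * ((n : ℝ) * δ) ≤ n :=
        (mul_le_mul_of_nonneg_left hnδ.le (Nat.cast_nonneg q)).trans h6
      have h8 : (0 : ℝ) < n := by exact_mod_cast hn
      have h9 : (n : ℝ) * (q * δ) ≤ n * 1 := by linarith
      exact le_of_mul_le_mul_left h9 h8
    · rw [centeredSum_eq_sum_Ico, centeredSum_eq_sum_Ico, ← Finset.sum_Ico_consecutive _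
        (show 1 ≤ 1 + q * b by omega) (show 1 + q * b ≤ 1 + (q * b + l) by omega),
        add_sub_cancel_left] at hx
      rw [show q * b + 1 = 1 + q * b by ring, show 1 + q * b + l = 1 + (q * b + l) by ring]
      exact hx

/-- A union bound over the exceedances. The factors `4` and `36` are the squared inverses of the
thresholds `ε / 2` and `ε / 6`, and `1 / δ + 1` bounds the number of blocks. -/
theorem measure_increment_le {ν Q Q' : ℝ} (hν : 2 < ν) :
    ∃ K : ℝ, 0 ≤ K ∧ ∀ (P : Measure Ω) (X : ℕ → ℕ → Ω → 𝒳) (F : Set (𝒳 → ℝ)) (ρ : F → F → ℝ)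
      (g h : ℕ → ℝ) (ε δ : ℝ) (n : ℕ),
      (∀ n i, 1 ≤ i → i ≤ n → Measurable (X n i)) → (∀ f ∈ F, Measurable f) →
      HasEnvelope P X F → IsSemimetric ρ → 0 < ε → 0 < δ → 1 ≤ n →
      ConditionS (ν / 2) Q g → ConditionS (ν / 2) Q' h →
      (∀ i j : ℕ, 1 ≤ i → i ≤ j → j ≤ n →
        outerExpectation P
          (fun ω => ((supCenteredSum P X (diffClass ρ δ) ν n i j ω : ENNReal) : EReal))
          ≤ ((g (j - i + 1) ^ (ν / 2) : ℝ) : EReal)) →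
      (∀ i j : ℕ, 1 ≤ i → i ≤ j → j ≤ n →
        outerExpectation P (fun ω => ((supCenteredSum P X F ν n i j ω : ENNReal) : EReal))
          ≤ ((h (j - i + 1) ^ (ν / 2) : ℝ) : EReal)) →
      P {ω | ENNReal.ofReal ε < ⨆ (p : Idx F) (q : Idx F) (_ : tau ρ p q ≤ δ),
        ENNReal.ofReal |process P X F n ω p - process P X F n ω q|} ≤
      ENNReal.ofReal (K * (4 / ε ^ 2 * (g n / n)) ^ (ν / 2)) +
        ENNReal.ofReal ((1 / δ + 1) *
          (K * (36 / ε ^ 2 * (h (⌊n * δ⌋₊ + 1) / n)) ^ (ν / 2))) := by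
  obtain ⟨K, hK, HK⟩ := maximal_tail_bound (Ω := Ω) (𝒳 := 𝒳) (Q := Q) hν
  obtain ⟨K', hK', HK'⟩ := maximal_tail_bound (Ω := Ω) (𝒳 := 𝒳) (Q := Q') hν
  refine ⟨max K K', le_max_of_le_left hK, ?_⟩
  intro P X F ρ g h ε δ n hX hF hEnv hρ hε hδ hn hgS hhS hg hh
  have hn0 : (0 : ℝ) < n := by exact_mod_cast hn
  have hsq : Real.sqrt n ^ 2 = n := Real.sq_sqrt hn0.le
  have hsp : 0 < Real.sqrt n := Real.sqrt_pos.2 hn0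
  refine (measure_mono (increment_subset hX hF hEnv hρ hδ hn)).trans
    ((measure_union_le _ _).trans (add_le_add ?_ ?_))
  · refine (HK P X _ g n hgS hg 1 n (ε / 2 * Real.sqrt n) le_rfl hn (by omega)
      (by positivity)).trans (ENNReal.ofReal_le_ofReal ?_)
    have hgn := hgS.nonneg n hn
    have e : g n / (ε / 2 * Real.sqrt n) ^ 2 = 4 / ε ^ 2 * (g n / n) := by
      rw [mul_pow, hsq]
      field_simp
      norm_num
    rw [e]
    exact mul_le_mul_of_nonneg_right (le_max_left _ _) (by positivity)
  · obtain ⟨b, hb⟩ : ∃ b, b = ⌊(n : ℝ) * δ⌋₊ + 1 := ⟨_, rfl⟩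
    rw [← hb]
    have hhb := hhS.nonneg b (by omega)
    have hblock : ∀ q : ℕ, P (exceedance P X F n (q * b + 1) (min b (n - q * b))
        (ε / 6 * Real.sqrt n)) ≤
        ENNReal.ofReal (max K K' * (36 / ε ^ 2 * (h b / n)) ^ (ν / 2)) := by
      intro q
      -- Truncated subtraction gives length zero to blocks starting past `n`; only empty sums remain
      -- there.
      rcases Nat.eq_zero_or_pos (min b (n - q * b)) with h0 | hpos
      · rw [h0]
        refine le_trans (le_of_eq ?_) (zero_le)
        rw [show exceedance P X F n (q * b + 1) 0 (ε / 6 * Real.sqrt n) = ∅ from ?_, measure_empty]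
        rw [Set.eq_empty_iff_forall_notMem]
        rintro ω ⟨f, -, l, hl, hlt⟩
        obtain rfl : l = 0 := by omega
        simp only [add_zero, Finset.Ico_self, Finset.sum_empty, abs_zero] at hlt
        have : 0 < ε / 6 * Real.sqrt n := by positivity
        linarith
      · refine (HK' P X _ h n hhS hh (q * b + 1) _ (ε / 6 * Real.sqrt n) (by omega) hpos
          (by omega) (by positivity)).trans (ENNReal.ofReal_le_ofReal ?_)
        have e : h b / (ε / 6 * Real.sqrt n) ^ 2 = 36 / ε ^ 2 * (h b / n) := by
          rw [mul_pow, hsq]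
          field_simp
          norm_num
        rw [← e]
        have hm := hhS.mono _ b hpos (min_le_left _ _)
        have hm0 := hhS.nonneg _ hpos
        refine mul_le_mul (le_max_right _ _) (Real.rpow_le_rpow (by positivity) ?_ (by linarith))
          (by positivity) (le_max_of_le_left hK)
        gcongr
    refine (measure_biUnion_finset_le _ _).trans ((Finset.sum_le_sum fun q _ => hblock q).trans ?_)
    rw [Finset.sum_const, Finset.card_range, nsmul_eq_mul,
      ENNReal.ofReal_mul (p := 1 / δ + 1) (by positivity)]
    have hcount : ((⌊1 / δ⌋₊ + 1 : ℕ) : ℝ≥0∞) ≤ ENNReal.ofReal (1 / δ + 1) := by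
      rw [← ENNReal.ofReal_natCast]
      apply ENNReal.ofReal_le_ofReal
      push_cast
      have := Nat.floor_le (show 0 ≤ 1 / δ by positivity)
      linarith
    gcongr

/-- The limit condition on `g` removes the change-of-function term. For the change of time, linear
growth of `h` beats the number of blocks because the exponent `ν / 2` exceeds one. -/
theorem aec_process (P : Measure Ω)
    (X : ℕ → ℕ → Ω → 𝒳)
    (hX : ∀ n i, 1 ≤ i → i ≤ n → Measurable (X n i))
    (F : Set (𝒳 → ℝ)) (hF : ∀ f ∈ F, Measurable f) (hEnv : HasEnvelope P X F)
    (ν : ℝ) (hν : 2 < ν) (ρ : F → F → ℝ) (hρ : IsSemimetric ρ)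
    (g : ℕ → ℝ → ℝ)
    (hg : ∀ (n : ℕ) (δ : ℝ), 0 < δ → ∀ i j : ℕ, 1 ≤ i → i ≤ j → j ≤ n →
      outerExpectation P
          (fun ω => ((supCenteredSum P X (diffClass ρ δ) ν n i j ω : ENNReal) : EReal))
        ≤ ((g (j - i + 1) δ ^ (ν / 2) : ℝ) : EReal))
    (Qg : ℝ) (hgS : ∀ δ : ℝ, 0 < δ → ConditionS (ν / 2) Qg (fun m => g m δ))
    (h : ℕ → ℝ)
    (hh : ∀ n i j : ℕ, 1 ≤ i → i ≤ j → j ≤ n →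
      outerExpectation P
          (fun ω => ((supCenteredSum P X F ν n i j ω : ENNReal) : EReal))
        ≤ ((h (j - i + 1) ^ (ν / 2) : ℝ) : EReal))
    (Qh : ℝ) (hhS : ConditionS (ν / 2) Qh h)
    (hglim : Tendsto (fun δ : ℝ => limsup (fun n : ℕ => ((g n δ / n : ℝ) : EReal)) atTop)
      (𝓝[>] 0) (𝓝 0))
    (C : ℝ) (hC : 0 ≤ C)
    (hhlim : ∀ ε : ℝ, 0 < ε → ε ≤ 1 →
      limsup (fun n : ℕ => ((h ⌊(n : ℝ) * ε⌋₊ / n : ℝ) : EReal)) atTop ≤ ((C * ε : ℝ) : EReal)) :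
    AEC P (process P X F) (tau ρ) := by
  intro ε hε
  obtain ⟨K, hK, HK⟩ := measure_increment_le (Ω := Ω) (𝒳 := 𝒳) (Q := Qg) (Q' := Qh) hν
  rw [ENNReal.tendsto_nhds_zero]
  intro e he
  obtain ⟨e', he'0, he'⟩ : ∃ e' : ℝ, 0 < e' ∧ ENNReal.ofReal e' ≤ e := by
    obtain ⟨x, hx0, hx⟩ := ENNReal.lt_iff_exists_nnreal_btwn.1 he
    exact ⟨x, by exact_mod_cast hx0, by simpa using hx.le⟩
  have hα : 0 < ν / 2 := by linarith
  obtain ⟨η, hη0, hη⟩ : ∃ η : ℝ, 0 < η ∧ K * (4 / ε ^ 2 * η) ^ (ν / 2) < e' / 2 := by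
    have hlim : Tendsto (fun η : ℝ => K * (4 / ε ^ 2 * η) ^ (ν / 2)) (𝓝[>] 0) (𝓝 0) := by
      have hc : Continuous fun η : ℝ => K * (4 / ε ^ 2 * η) ^ (ν / 2) :=
        continuous_const.mul ((continuous_const.mul continuous_id).rpow_const
          fun _ => Or.inr hα.le)
      have := hc.tendsto 0
      simp only [mul_zero, Real.zero_rpow hα.ne'] at this
      exact this.mono_left nhdsWithin_le_nhds
    obtain ⟨η, h1, h2⟩ := ((hlim.eventually_lt_const (half_pos he'0)).and
      self_mem_nhdsWithin).exists
    exact ⟨η, h2, h1⟩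
  have hsmall : ∀ᶠ δ : ℝ in 𝓝[>] 0, (1 / δ + 1) *
      (K * (36 / ε ^ 2 * ((2 * C + 1) * δ)) ^ (ν / 2)) < e' / 2 := by
    -- Here `1 / δ + 1 = (1 + δ) / δ`, and the division lowers the power `δ ^ (ν / 2)` by one.
    have hlim : Tendsto (fun δ : ℝ => (1 + δ) * (K * (36 / ε ^ 2 * (2 * C + 1)) ^ (ν / 2)) *
        δ ^ (ν / 2 - 1)) (𝓝[>] 0) (𝓝 0) := by
      have hc : Continuous fun δ : ℝ => (1 + δ) * (K * (36 / ε ^ 2 * (2 * C + 1)) ^ (ν / 2)) *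
          δ ^ (ν / 2 - 1) :=
        ((continuous_const.add continuous_id).mul continuous_const).mul
          (continuous_id.rpow_const fun _ => Or.inr (by linarith))
      have := hc.tendsto 0
      rw [Real.zero_rpow (by linarith), mul_zero] at this
      exact this.mono_left nhdsWithin_le_nhds
    filter_upwards [hlim.eventually_lt_const (half_pos he'0), self_mem_nhdsWithin] with δ h1 h2
    have hδ : 0 < δ := h2
    refine lt_of_eq_of_lt ?_ h1
    rw [← mul_assoc (36 / ε ^ 2), Real.mul_rpow (by positivity) hδ.le, Real.rpow_sub_one hδ.ne']
    field_simp
  have hδhalf : ∀ᶠ δ : ℝ in 𝓝[>] 0, δ < 1 / 2 :=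
    nhdsWithin_le_nhds (eventually_lt_nhds (by norm_num))
  have hη' : (0 : EReal) < (η : EReal) := by exact_mod_cast hη0
  filter_upwards [hsmall, hδhalf, self_mem_nhdsWithin, hglim.eventually_lt_const hη']
    with δ hδs hδ2 hδ0 hgη
  have hδ : 0 < δ := hδ0
  have hgev : ∀ᶠ n : ℕ in atTop, g n δ / n < η := by
    filter_upwards [eventually_lt_of_limsup_lt hgη] with n hn
    exact_mod_cast hn
  -- Doubling `δ` absorbs the `+ 1` in the block length; the extra `δ` in the bound gives the strict
  -- inequality needed to leave the limsup.
  have hhev : ∀ᶠ n : ℕ in atTop, h ⌊(n : ℝ) * (2 * δ)⌋₊ / n < (2 * C + 1) * δ := by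
    have hlt : limsup (fun n : ℕ => ((h ⌊(n : ℝ) * (2 * δ)⌋₊ / n : ℝ) : EReal)) atTop <
        (((2 * C + 1) * δ : ℝ) : EReal) := by
      refine (hhlim (2 * δ) (by linarith) (by linarith)).trans_lt ?_
      rw [EReal.coe_lt_coe_iff]
      linarith
    filter_upwards [eventually_lt_of_limsup_lt hlt] with n hn
    exact_mod_cast hn
  have hbig : ∀ᶠ n : ℕ in atTop, ⌊(n : ℝ) * δ⌋₊ + 1 ≤ ⌊(n : ℝ) * (2 * δ)⌋₊ := by
    filter_upwards [(tendsto_natCast_atTop_atTop (R := ℝ)).eventually_ge_atTop (1 / δ)] with n hn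
    apply Nat.le_floor
    push_cast
    rw [div_le_iff₀ hδ] at hn
    have := Nat.floor_le (show 0 ≤ (n : ℝ) * δ by positivity)
    linarith
  refine limsup_le_of_le (by isBoundedDefault) ?_
  filter_upwards [hgev, hhev, hbig, eventually_ge_atTop 1] with n h1 h2 h3 h4
  refine (HK P X F ρ (fun m => g m δ) h ε δ n hX hF hEnv hρ hε hδ h4 (hgS δ hδ) hhS
    (hg n δ hδ) (hh n)).trans ?_
  refine le_trans ?_ he'
  have hg0 : 0 ≤ g n δ := (hgS δ hδ).nonneg n h4
  have hh0 := hhS.nonneg (⌊(n : ℝ) * δ⌋₊ + 1) (by omega)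
  have hn0 : (0 : ℝ) < n := by exact_mod_cast h4
  have hh3 : h (⌊(n : ℝ) * δ⌋₊ + 1) / n ≤ (2 * C + 1) * δ :=
    (div_le_div_of_nonneg_right (hhS.mono _ _ (by omega) h3) hn0.le).trans h2.le
  have hb1 : K * (4 / ε ^ 2 * (g n δ / n)) ^ (ν / 2) ≤ e' / 2 := by
    refine le_trans ?_ hη.le
    gcongr
  have hb2 : (1 / δ + 1) * (K * (36 / ε ^ 2 * (h (⌊(n : ℝ) * δ⌋₊ + 1) / n)) ^ (ν / 2)) ≤
      e' / 2 := by
    refine le_trans ?_ hδs.le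
    gcongr
  rw [← ENNReal.ofReal_add (by positivity) (by positivity)]
  exact ENNReal.ofReal_le_ofReal (by linarith)

end Equicontinuity

/-! ### Oscillation events and step functions over finite nets -/

section Oscillation

variable {T : Type*}

/-- The oscillation of `z` over pairs at `τ`-distance at most `δ` exceeds `ε`. -/
def OscExceeds (τ : T → T → ℝ) (δ ε : ℝ) (z : T → ℝ) : Prop :=
  ∃ s t, τ s t ≤ δ ∧ ε < |z s - z t|

theorem AEC.exists_limsup_lt {Ω : Type*} [MeasurableSpace Ω] {P : Measure Ω} {Z : ℕ → Ω → T → ℝ}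
    {τ : T → T → ℝ} (h : AEC P Z τ) {ε : ℝ} (hε : 0 < ε) {η : ℝ≥0∞} (hη : 0 < η) :
    ∃ δ : ℝ, 0 < δ ∧ limsup (fun n => P {ω | OscExceeds τ δ ε (Z n ω)}) atTop < η := by
  obtain ⟨δ, h1, h2⟩ := (((h ε hε).eventually_lt_const hη).and self_mem_nhdsWithin).exists
  refine ⟨δ, h2, lt_of_eq_of_lt ?_ h1⟩
  congr 1
  ext n
  congr 1
  ext ω
  simp only [Set.mem_ofPred_eq, lt_iSup_iff, OscExceeds]
  refine exists_congr fun s => exists_congr fun t => ?_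
  rw [exists_prop, ENNReal.ofReal_lt_ofReal_iff_of_nonneg hε.le]

/-- Bounded step functions on `T` that depend only on the cell `π t` of `t`. -/
def stepFun {A : Finset T} (π : T → A) (x : A → ℝ) : LInf T :=
  ⟨fun t => x (π t), memℓp_infty ⟨‖x‖, by
    rintro _ ⟨t, rfl⟩
    exact norm_le_pi_norm x (π t)⟩⟩

theorem continuous_stepFun {A : Finset T} (π : T → A) : Continuous (stepFun π) := by
  refine (LipschitzWith.of_dist_le_mul (K := 1) fun x y => ?_).continuous
  rw [NNReal.coe_one, one_mul, dist_eq_norm]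
  refine lp.norm_le_of_forall_le dist_nonneg fun t => ?_
  have := dist_le_pi_dist x y (π t)
  rwa [Real.dist_eq] at this

theorem continuous_eval (t : T) : Continuous fun z : LInf T => z t := by
  refine (LipschitzWith.of_dist_le_mul (K := 1) fun x y => ?_).continuous
  rw [NNReal.coe_one, one_mul, Real.dist_eq, dist_eq_norm x y]
  exact lp.norm_apply_le_norm (by simp) (x - y) t

theorem continuous_restrict (A : Finset T) : Continuous fun (z : LInf T) (t : A) => z t :=
  continuous_pi fun t => continuous_eval (t : T)

theorem dist_stepFun_le {τ : T → T → ℝ} {δ ε : ℝ} (hε : 0 ≤ ε) {A : Finset T} {π : T → A}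
    (hπ : ∀ t, τ t (π t) ≤ δ) {z : LInf T} (hz : ¬ OscExceeds τ δ ε z) :
    dist z (stepFun π fun t => z t) ≤ ε := by
  rw [dist_eq_norm]
  refine lp.norm_le_of_forall_le hε fun t => ?_
  by_contra! H
  exact hz ⟨t, π t, hπ t, H⟩

theorem IsTotallyBounded.exists_net {τ : T → T → ℝ} (h : IsTotallyBounded τ) {δ : ℝ}
    (hδ : 0 < δ) : ∃ (A : Finset T) (π : T → A), ∀ t, τ t (π t) ≤ δ := by
  obtain ⟨A, hA⟩ := h δ hδ
  choose f hf hlt using hA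
  exact ⟨A, fun t => ⟨f t, hf t⟩, fun t => (hlt t).le⟩

end Oscillation

/-! ### Oscillations of the finite-dimensional limits -/

section Fidi

variable {Ω : Type*} [MeasurableSpace Ω] {P : Measure Ω} {T : Type*}
  {Z : ℕ → Ω → T → ℝ} {m : (I : Finset T) → ProbabilityMeasure (I → ℝ)}

/-- Restricting a vector is continuous, so the restricted law and the smaller marginal are limits of
the same integrals. -/
theorem FidiConverges.isProjectiveMeasureFamily (hm : FidiConverges P Z m) :
    IsProjectiveMeasureFamily (α := fun _ : T => ℝ) fun I => (m I : Measure (I → ℝ)) := by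
  intro I J hJI
  have hc : Continuous (Finset.restrict₂ (π := fun _ : T => ℝ) hJI) :=
    continuous_pi fun j => continuous_apply _
  have : IsProbabilityMeasure
      ((m I : Measure (I → ℝ)).map (Finset.restrict₂ (π := fun _ : T => ℝ) hJI)) :=
    Measure.isProbabilityMeasure_map hc.measurable.aemeasurable
  refine ext_of_forall_integral_eq_of_IsFiniteMeasure fun φ => ?_
  rw [integral_map hc.measurable.aemeasurable φ.continuous.aestronglyMeasurable]
  exact tendsto_nhds_unique (hm J φ) (hm I (φ.compContinuous ⟨_, hc⟩))

variable [IsProbabilityMeasure P]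

theorem FidiConverges.measure_open_le (hm : FidiConverges P Z m)
    (hZ : ∀ n t, Measurable fun ω => Z n ω t) (I : Finset T) {G : Set (I → ℝ)} (hG : IsOpen G) :
    (m I : Measure (I → ℝ)) G ≤ liminf (fun n => P {ω | (fun t : I => Z n ω t) ∈ G}) atTop := by
  have hmeas : ∀ n, Measurable fun ω (t : I) => Z n ω t := fun n =>
    measurable_pi_lambda _ fun t => hZ n t
  let law : ℕ → ProbabilityMeasure (I → ℝ) := fun n =>
    ⟨P.map fun ω (t : I) => Z n ω t, Measure.isProbabilityMeasure_map (hmeas n).aemeasurable⟩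
  have hlim : Tendsto law atTop (𝓝 (m I)) := by
    rw [ProbabilityMeasure.tendsto_iff_forall_integral_tendsto]
    intro φ
    refine (hm I φ).congr fun n => ?_
    exact (integral_map (hmeas n).aemeasurable φ.continuous.aestronglyMeasurable).symm
  have h := ProbabilityMeasure.le_liminf_measure_open_of_tendsto hlim hG
  refine h.trans (le_of_eq ?_)
  congr 1
  ext n
  exact Measure.map_apply (hmeas n) hG.measurableSet

theorem isOpen_oscExceeds_restrict (τ : T → T → ℝ) (δ ε : ℝ) (I : Finset T) :
    IsOpen {x : I → ℝ | OscExceeds (fun s t : I => τ s t) δ ε x} := by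
  have : {x : I → ℝ | OscExceeds (fun s t : I => τ s t) δ ε x} =
      ⋃ (s : I) (t : I) (_ : τ s t ≤ δ), {x | ε < |x s - x t|} := by
    ext x
    simp [OscExceeds]
  rw [this]
  refine isOpen_iUnion fun s => isOpen_iUnion fun t => isOpen_iUnion fun _ => ?_
  exact isOpen_lt continuous_const ((continuous_apply s).sub (continuous_apply t)).abs

/-- The event is open in finitely many coordinates, so portmanteau applies, and restricting the
indices only shrinks it. The resulting bound does not depend on `I`. -/
theorem FidiConverges.measure_oscExceeds_le (hm : FidiConverges P Z m)
    (hZ : ∀ n t, Measurable fun ω => Z n ω t) (τ : T → T → ℝ) (δ ε : ℝ) (I : Finset T) :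
    (m I : Measure (I → ℝ)) {x | OscExceeds (fun s t : I => τ s t) δ ε x} ≤
      limsup (fun n => P {ω | OscExceeds τ δ ε (Z n ω)}) atTop := by
  refine (hm.measure_open_le hZ I (isOpen_oscExceeds_restrict τ δ ε I)).trans
    ((liminf_le_limsup).trans (limsup_le_limsup (Eventually.of_forall fun n => measure_mono ?_)))
  rintro ω ⟨s, t, hst, hlt⟩
  exact ⟨s, t, hst, hlt⟩

theorem isOpen_oscExceeds (τ : T → T → ℝ) (δ ε : ℝ) : IsOpen {z : LInf T | OscExceeds τ δ ε z} := by
  have : {z : LInf T | OscExceeds τ δ ε z} =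
      ⋃ (s : T) (t : T) (_ : τ s t ≤ δ), {z : LInf T | ε < |z s - z t|} := by
    ext x
    simp [OscExceeds]
  rw [this]
  refine isOpen_iUnion fun s => isOpen_iUnion fun t => isOpen_iUnion fun _ => ?_
  exact isOpen_lt continuous_const ((continuous_eval s).sub (continuous_eval t)).abs

/-- A tight law is τ-additive, so its oscillations are controlled by those of its marginals. -/
theorem measure_oscExceeds_le_of_tight {L : ProbabilityMeasure (LInf T)}
    (hL : IsTightMeasureSet {(L : Measure (LInf T))}) (hLm : HasMarginals L m)
    {τ : T → T → ℝ} {δ ε : ℝ} {c : ℝ≥0∞}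
    (hc : ∀ I : Finset T,
      (m I : Measure (I → ℝ)) {x | OscExceeds (fun s t : I => τ s t) δ ε x} ≤ c) :
    (L : Measure (LInf T)) {z : LInf T | OscExceeds τ δ ε z} ≤ c := by
  classical
  refine ENNReal.le_of_forall_pos_le_add fun η hη _ => ?_
  obtain ⟨K, hK, hKL⟩ := isTightMeasureSet_iff_exists_isCompact_measure_compl_le.1 hL η
    (by exact_mod_cast hη)
  have hKL' := hKL _ rfl
  refine le_of_forall_lt fun r hr => ?_
  obtain ⟨C, hCU, hC, hrC⟩ := (isOpen_oscExceeds τ δ ε).exists_lt_isClosed hr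
  refine hrC.trans_le ?_
  -- The event is a possibly uncountable union of open sets, one per pair; on a compact part
  -- finitely many pairs, hence one finite `I`, suffice.
  have hKC : IsCompact (K ∩ C) := hK.inter_right hC
  obtain ⟨J, hJ⟩ := hKC.elim_finite_subcover
    (fun p : {p : T × T // τ p.1 p.2 ≤ δ} => {z : LInf T | ε < |z p.1.1 - z p.1.2|})
    (fun p => isOpen_lt continuous_const
      ((continuous_eval p.1.1).sub (continuous_eval p.1.2)).abs)
    (fun z hz => by
      obtain ⟨s, t, hst, hlt⟩ := hCU hz.2
      exact Set.mem_iUnion.2 ⟨⟨(s, t), hst⟩, hlt⟩)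
  obtain ⟨I, hI⟩ : ∃ I : Finset T, I = J.image (fun p => p.1.1) ∪ J.image (fun p => p.1.2) :=
    ⟨_, rfl⟩
  have hsub : K ∩ C ⊆ (fun (z : LInf T) (t : I) => z t) ⁻¹'
      {x | OscExceeds (fun s t : I => τ s t) δ ε x} := by
    intro z hz
    obtain ⟨p, hp, hlt⟩ := Set.mem_iUnion₂.1 (hJ hz)
    refine ⟨⟨p.1.1, ?_⟩, ⟨p.1.2, ?_⟩, p.2, hlt⟩
    · rw [hI]
      exact Finset.mem_union_left _ (Finset.mem_image_of_mem (fun p => p.1.1) hp)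
    · rw [hI]
      exact Finset.mem_union_right _ (Finset.mem_image_of_mem (fun p => p.1.2) hp)
  calc (L : Measure (LInf T)) C ≤ (L : Measure (LInf T)) (K ∩ C ∪ Kᶜ) := by
        refine measure_mono fun z hz => ?_
        by_cases h : z ∈ K
        · exact Or.inl ⟨h, hz⟩
        · exact Or.inr h
    _ ≤ (L : Measure (LInf T)) (K ∩ C) + (L : Measure (LInf T)) Kᶜ := measure_union_le _ _
    _ ≤ c + η := by
        refine add_le_add ((measure_mono hsub).trans ?_) hKL'
        rw [← Measure.map_apply (continuous_restrict I).measurable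
          (isOpen_oscExceeds_restrict τ δ ε I).measurableSet, hLm I]
        exact hc I

end Fidi

/-! ### Lipschitz majorants by sup-convolution -/

section LipschitzApproximation

variable {E : Type*} [PseudoMetricSpace E]

/-- The smallest `k`-Lipschitz majorant of `φ`. -/
noncomputable def supConvolution (φ : E →ᵇ ℝ) (k : ℝ) (x : E) : ℝ := ⨆ y, (φ y - k * dist x y)

variable (φ : E →ᵇ ℝ) {k : ℝ}

theorem bddAbove_supConvolution (hk : 0 ≤ k) (x : E) :
    BddAbove (Set.range fun y => φ y - k * dist x y) := by
  refine ⟨‖φ‖, ?_⟩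
  rintro _ ⟨y, rfl⟩
  have h1 := (abs_le.1 (φ.norm_coe_le_norm y)).2
  have h2 : 0 ≤ k * dist x y := mul_nonneg hk dist_nonneg
  simp only
  linarith

theorem le_supConvolution (hk : 0 ≤ k) (x : E) : φ x ≤ supConvolution φ k x := by
  have := le_ciSup (bddAbove_supConvolution φ hk x) x
  simpa [supConvolution] using this

theorem abs_supConvolution_le (hk : 0 ≤ k) (x : E) : |supConvolution φ k x| ≤ ‖φ‖ := by
  have : Nonempty E := ⟨x⟩
  rw [abs_le]
  refine ⟨(abs_le.1 (φ.norm_coe_le_norm x)).1.trans (le_supConvolution φ hk x), ?_⟩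
  refine ciSup_le fun y => ?_
  have h1 := (abs_le.1 (φ.norm_coe_le_norm y)).2
  have h2 : 0 ≤ k * dist x y := mul_nonneg hk dist_nonneg
  linarith

theorem supConvolution_le_add (hk : 0 ≤ k) (x y : E) :
    supConvolution φ k x ≤ supConvolution φ k y + k * dist x y := by
  have : Nonempty E := ⟨x⟩
  refine ciSup_le fun w => ?_
  have h1 := le_ciSup (bddAbove_supConvolution φ hk y) w
  have h2 : k * dist y w ≤ k * (dist x y + dist x w) :=
    mul_le_mul_of_nonneg_left (dist_triangle_left y w x) hk
  change φ w - k * dist y w ≤ supConvolution φ k y at h1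
  linarith

theorem continuous_supConvolution (hk : 0 ≤ k) : Continuous (supConvolution φ k) := by
  refine (LipschitzWith.of_dist_le_mul (K := k.toNNReal) fun x y => ?_).continuous
  rw [Real.coe_toNNReal k hk, Real.dist_eq, abs_le]
  have h1 := supConvolution_le_add φ hk x y
  have h2 := supConvolution_le_add φ hk y x
  rw [dist_comm y x] at h2
  constructor <;> linarith

theorem tendsto_supConvolution (x : E) :
    Tendsto (fun k : ℕ => supConvolution φ k x) atTop (𝓝 (φ x)) := by
  have : Nonempty E := ⟨x⟩
  rw [tendsto_order]
  refine ⟨fun a ha => Eventually.of_forall fun k =>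
    ha.trans_le (le_supConvolution φ k.cast_nonneg x), fun a ha => ?_⟩
  obtain ⟨b, hxb, hba⟩ := exists_between ha
  obtain ⟨δ, hδ, hball⟩ := Metric.eventually_nhds_iff.1
    (φ.continuous.continuousAt.eventually_lt_const hxb : ∀ᶠ y in 𝓝 x, φ y < b)
  -- Past this threshold the penalty `k * δ` is at least `‖φ‖ - b`, so points outside the ball
  -- contribute at most `b`.
  filter_upwards [(tendsto_natCast_atTop_atTop (R := ℝ)).eventually_ge_atTop ((‖φ‖ - b) / δ)]
    with k hk
  rw [div_le_iff₀ hδ] at hk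
  refine lt_of_le_of_lt (ciSup_le fun y => ?_) hba
  rcases lt_or_ge (dist y x) δ with h | h
  · have h2 : 0 ≤ (k : ℝ) * dist x y := by positivity
    linarith [hball h]
  · have h1 := (abs_le.1 (φ.norm_coe_le_norm y)).2
    have h2 : (k : ℝ) * δ ≤ k * dist x y := by
      rw [dist_comm]
      exact mul_le_mul_of_nonneg_left h k.cast_nonneg
    linarith

/-- Integrals of bounded continuous functions are approximated from above by those of
Lipschitz functions. -/
theorem exists_lipschitz_majorant [MeasurableSpace E] [BorelSpace E] (μ : Measure E)
    [IsProbabilityMeasure μ] {e : ℝ} (he : 0 < e) :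
    ∃ (ψ : E →ᵇ ℝ) (k : ℝ), 0 ≤ k ∧ (∀ x, φ x ≤ ψ x) ∧ (∀ x y, ψ x ≤ ψ y + k * dist x y) ∧
      ∫ x, ψ x ∂μ < ∫ x, φ x ∂μ + e := by
  have hlim : Tendsto (fun k : ℕ => ∫ x, supConvolution φ k x ∂μ) atTop (𝓝 (∫ x, φ x ∂μ)) :=
    tendsto_integral_of_dominated_convergence (fun _ => ‖φ‖)
      (fun k => (continuous_supConvolution φ k.cast_nonneg).measurable.aestronglyMeasurable)
      (integrable_const _)
      (fun k => Eventually.of_forall fun x => abs_supConvolution_le φ k.cast_nonneg x)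
      (Eventually.of_forall fun x => tendsto_supConvolution φ x)
  obtain ⟨k, hk⟩ := (hlim.eventually_lt_const (show ∫ x, φ x ∂μ < ∫ x, φ x ∂μ + e by
    linarith)).exists
  exact ⟨BoundedContinuousFunction.ofNormedAddCommGroup (supConvolution φ k)
    (continuous_supConvolution φ k.cast_nonneg) ‖φ‖
    (fun x => abs_supConvolution_le φ k.cast_nonneg x), k, k.cast_nonneg,
    le_supConvolution φ k.cast_nonneg, supConvolution_le_add φ k.cast_nonneg, hk⟩

end LipschitzApproximation

/-! ### Weak convergence to a tight law with the given marginals -/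

section WeakConvergence

variable {Ω : Type*} [MeasurableSpace Ω] {P : Measure Ω} {T : Type*}

theorem expectation_coe {f : Ω → ℝ} (hf : Integrable f P) :
    expectation P (fun ω => ((f ω : ℝ) : EReal)) = ((∫ ω, f ω ∂P : ℝ) : EReal) := by
  have h1 : ∫⁻ ω, ENNReal.ofReal (f ω) ∂P ≠ ⊤ := hf.lintegral_lt_top.ne
  have h2 : ∫⁻ ω, ENNReal.ofReal (-f ω) ∂P ≠ ⊤ := hf.neg.lintegral_lt_top.ne
  have h3 : ∀ x : ℝ, (x : EReal).toENNReal = ENNReal.ofReal x := fun x => by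
    simp [EReal.toENNReal]
  unfold expectation
  simp only [← EReal.coe_neg, h3]
  rw [integral_eq_lintegral_pos_part_sub_lintegral_neg_part hf, EReal.coe_sub,
    ← EReal.coe_ennreal_toReal h1, ← EReal.coe_ennreal_toReal h2]

theorem outerExpectation_le_integral {Y f : Ω → ℝ} (hf : Measurable f) (hfi : Integrable f P)
    (hYf : ∀ ω, Y ω ≤ f ω) :
    outerExpectation P (fun ω => ((Y ω : ℝ) : EReal)) ≤ ((∫ ω, f ω ∂P : ℝ) : EReal) := by
  refine sInf_le ⟨fun ω => ((f ω : ℝ) : EReal), hf.coe_real_ereal,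
    fun ω => EReal.coe_le_coe_iff.2 (hYf ω), Or.inl ?_, (expectation_coe hfi).symm⟩
  have h3 : ∀ x : ℝ, (x : EReal).toENNReal = ENNReal.ofReal x := fun x => by
    simp [EReal.toENNReal]
  simp only [h3]
  exact hfi.lintegral_lt_top.ne

theorem integral_le_outerExpectation {Y f : Ω → ℝ} (hfi : Integrable f P)
    (hfY : ∀ ω, f ω ≤ Y ω) :
    ((∫ ω, f ω ∂P : ℝ) : EReal) ≤ outerExpectation P (fun ω => ((Y ω : ℝ) : EReal)) := by
  refine le_sInf ?_
  rintro _ ⟨U, -, hYU, -, rfl⟩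
  rw [← expectation_coe hfi]
  have hle : ∀ ω, ((f ω : ℝ) : EReal) ≤ U ω := fun ω =>
    (EReal.coe_le_coe_iff.2 (hfY ω)).trans (hYU ω)
  unfold expectation
  refine EReal.sub_le_sub ?_ ?_
  · exact_mod_cast lintegral_mono fun ω => EReal.toENNReal_le_toENNReal (hle ω)
  · exact_mod_cast lintegral_mono fun ω =>
      EReal.toENNReal_le_toENNReal (EReal.neg_le_neg_iff.2 (hle ω))

variable [IsProbabilityMeasure P]

/-- Pointwise comparison off an exceptional set, integrated. -/
theorem integral_le_of_le_off {α : Type*} [MeasurableSpace α] {μ : Measure α}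
    [IsProbabilityMeasure μ] {f g : α → ℝ} (hf : Integrable f μ) (hg : Integrable g μ) {S : Set α}
    (hS : MeasurableSet S) {a b η : ℝ} (hb : 0 ≤ b) (hη : 0 ≤ η)
    (hμS : μ S ≤ ENNReal.ofReal η) (hoff : ∀ x ∉ S, f x ≤ g x + a)
    (hon : ∀ x, f x ≤ g x + a + b) : ∫ x, f x ∂μ ≤ ∫ x, g x ∂μ + a + b * η := by
  have hint : Integrable (fun x => g x + a + S.indicator (fun _ => b) x) μ :=
    (hg.add (integrable_const a)).add ((integrable_const b).indicator hS)
  have h1 : ∫ x, f x ∂μ ≤ ∫ x, (g x + a + S.indicator (fun _ => b) x) ∂μ := by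
    refine integral_mono hf hint fun x => ?_
    by_cases hx : x ∈ S
    · simpa [hx] using hon x
    · simpa [hx] using hoff x hx
  rw [integral_add (f := fun x => g x + a) (hg.add (integrable_const a)) ((integrable_const b).indicator hS),
    integral_add hg (integrable_const a), integral_indicator_const _ hS] at h1
  have h2 : μ.real S ≤ η := ENNReal.toReal_le_of_le_ofReal hη hμS
  simp only [integral_const, probReal_univ, smul_eq_mul, one_mul] at h1
  nlinarith

variable {Z : ℕ → Ω → LInf T} {m : (I : Finset T) → ProbabilityMeasure (I → ℝ)} {τ : T → T → ℝ}

/-- Replace `φ` by a Lipschitz `ψ` and evaluate `ψ` at the step function through a finite net. This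
costs `k * ε` off the oscillation event and at most `2 * ‖ψ‖` more on it, once under `L` and once
under `P`, with fidi-convergence in between. -/
theorem exists_integral_majorant (hZ : ∀ n t, Measurable fun ω => Z n ω t)
    (hτ : IsTotallyBounded τ) (hAEC : AEC P (fun n ω t => Z n ω t) τ)
    (hm : FidiConverges P (fun n ω t => Z n ω t) m) {L : ProbabilityMeasure (LInf T)}
    (hL : IsTightMeasureSet {(L : Measure (LInf T))}) (hLm : HasMarginals L m)
    (φ : LInf T →ᵇ ℝ) {e : ℝ} (he : 0 < e) :
    ∀ᶠ n in atTop, ∃ U : Ω → ℝ, Measurable U ∧ Integrable U P ∧ (∀ ω, φ (Z n ω) ≤ U ω) ∧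
      ∫ ω, U ω ∂P < ∫ z, φ z ∂(L : Measure (LInf T)) + e := by
  obtain ⟨ψ, k, hk, hφψ, hψ, hψint⟩ :=
    exists_lipschitz_majorant φ (L : Measure (LInf T)) (show 0 < e / 4 by positivity)
  obtain ⟨M, hM⟩ : ∃ M, M = 2 * ‖ψ‖ := ⟨_, rfl⟩
  have hM0 : 0 ≤ M := hM ▸ by positivity
  have hosc : ∀ x y, ψ x ≤ ψ y + M := fun x y => by
    have h1 := (abs_le.1 (ψ.norm_coe_le_norm x)).2
    have h2 := (abs_le.1 (ψ.norm_coe_le_norm y)).1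
    linarith
  -- Error budget: `e / 4` for `ψ`, `e / 8` for fidi-convergence, and two copies each of `k * ε ≤ e
  -- / 8` and `M * η ≤ e / 8`, in total `7 * e / 8`.
  obtain ⟨ε, hε⟩ : ∃ ε, ε = e / (8 * (k + 1)) := ⟨_, rfl⟩
  obtain ⟨η, hη⟩ : ∃ η, η = e / (8 * (M + 1)) := ⟨_, rfl⟩
  have hε0 : 0 < ε := hε ▸ by positivity
  have hη0 : 0 < η := hη ▸ by positivity
  have hkε : k * ε ≤ e / 8 := by
    have : ε * (k + 1) = e / 8 := by
      rw [hε]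
      field_simp
    linarith
  have hMη : M * η ≤ e / 8 := by
    have : η * (M + 1) = e / 8 := by
      rw [hη]
      field_simp
    linarith
  obtain ⟨δ, hδ, hlim⟩ := hAEC.exists_limsup_lt hε0 (ENNReal.ofReal_pos.2 hη0)
  obtain ⟨A, π, hπ⟩ := hτ.exists_net hδ
  have hLosc : (L : Measure (LInf T)) {z : LInf T | OscExceeds τ δ ε z} ≤ ENNReal.ofReal η :=
    measure_oscExceeds_le_of_tight hL hLm fun I =>
      (hm.measure_oscExceeds_le hZ τ δ ε I).trans hlim.le
  let χ : (A → ℝ) →ᵇ ℝ := ψ.compContinuous ⟨stepFun π, continuous_stepFun π⟩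
  have hχ : ∫ x, χ x ∂(m A : Measure (A → ℝ)) ≤
      ∫ z, ψ z ∂(L : Measure (LInf T)) + k * ε + M * η := by
    rw [← hLm A, integral_map (continuous_restrict A).measurable.aemeasurable
      χ.continuous.aestronglyMeasurable]
    refine integral_le_of_le_off
      ((χ.compContinuous ⟨_, continuous_restrict A⟩).integrable _) (ψ.integrable _)
      (isOpen_oscExceeds τ δ ε).measurableSet hM0 hη0.le hLosc (fun z hz => ?_) (fun z => ?_)
    · refine (hψ _ z).trans (add_le_add le_rfl (mul_le_mul_of_nonneg_left ?_ hk))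
      rw [dist_comm]
      exact dist_stepFun_le hε0.le hπ hz
    · have h1 := hosc (stepFun π fun t => z t) z
      have h2 : 0 ≤ k * ε := by positivity
      change ψ (stepFun π fun t => z t) ≤ _
      linarith
  have hconv := (hm A χ).eventually_lt_const (show ∫ x, χ x ∂(m A : Measure (A → ℝ)) <
    ∫ x, χ x ∂(m A : Measure (A → ℝ)) + e / 8 by linarith)
  filter_upwards [hconv, eventually_lt_of_limsup_lt hlim] with n hn hPn
  -- The oscillation event of the process may be nonmeasurable; its measurable hull has the same
  -- outer probability.
  obtain ⟨S, hS⟩ : ∃ S, S = toMeasurable P {ω | OscExceeds τ δ ε (Z n ω)} := ⟨_, rfl⟩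
  have hSm : MeasurableSet S := hS ▸ measurableSet_toMeasurable _ _
  have hPS : P S ≤ ENNReal.ofReal η := by
    rw [hS, measure_toMeasurable]
    exact hPn.le
  have hfm : Measurable fun ω => χ fun t : A => Z n ω t :=
    χ.continuous.measurable.comp (measurable_pi_lambda _ fun t => hZ n t)
  have hfi : Integrable (fun ω => χ fun t : A => Z n ω t) P :=
    (integrable_const ‖χ‖).mono' hfm.aestronglyMeasurable
      (Eventually.of_forall fun ω => χ.norm_coe_le_norm _)
  have hUm : Measurable fun ω => (χ fun t : A => Z n ω t) + k * ε + S.indicator (fun _ => M) ω :=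
    (hfm.add_const _).add (measurable_const.indicator hSm)
  have hUi : Integrable
      (fun ω => (χ fun t : A => Z n ω t) + k * ε + S.indicator (fun _ => M) ω) P :=
    (hfi.add (integrable_const _)).add ((integrable_const M).indicator hSm)
  refine ⟨_, hUm, hUi, fun ω => (hφψ _).trans ?_, ?_⟩
  · by_cases hω : ω ∈ S
    · have h1 := hosc (Z n ω) (stepFun π fun t => Z n ω t)
      have h2 : 0 ≤ k * ε := by positivity
      simp only [hω, Set.indicator_of_mem]
      change ψ (Z n ω) ≤ ψ (stepFun π fun t => Z n ω t) + k * ε + M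
      linarith
    · simp only [hω, not_false_eq_true, Set.indicator_of_notMem, add_zero]
      refine (hψ _ (stepFun π fun t => Z n ω t)).trans
        (add_le_add le_rfl (mul_le_mul_of_nonneg_left (dist_stepFun_le hε0.le hπ fun h => ?_) hk))
      exact hω (hS ▸ subset_toMeasurable P _ h)
  · have h1 := integral_le_of_le_off (μ := P) hUi hfi hSm hM0 hη0.le hPS (a := k * ε)
      (fun ω hω => by simp [hω])
      (fun ω => by
        by_cases hω : ω ∈ S
        · simp [hω]
        · simpa [hω] using hM0)
    linarith

theorem weaklyConverges_of_aec (hZ : ∀ n t, Measurable fun ω => Z n ω t)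
    (hτ : IsTotallyBounded τ) (hAEC : AEC P (fun n ω t => Z n ω t) τ)
    (hm : FidiConverges P (fun n ω t => Z n ω t) m) {L : ProbabilityMeasure (LInf T)}
    (hL : IsTightMeasureSet {(L : Measure (LInf T))}) (hLm : HasMarginals L m) :
    WeaklyConverges P Z L := by
  intro φ
  rw [tendsto_order]
  constructor
  · intro a ha
    obtain ⟨b, hab, hb⟩ := EReal.lt_iff_exists_real_btwn.1 ha
    rw [EReal.coe_lt_coe_iff] at hb
    filter_upwards [exists_integral_majorant hZ hτ hAEC hm hL hLm (-φ) (sub_pos.2 hb)]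
      with n hn
    obtain ⟨U, -, hUi, hφU, hU⟩ := hn
    refine hab.trans_le (le_trans ?_ (integral_le_outerExpectation hUi.neg fun ω => ?_))
    · rw [EReal.coe_le_coe_iff]
      simp only [BoundedContinuousFunction.coe_neg, Pi.neg_apply, integral_neg] at hU ⊢
      linarith
    · have := hφU ω
      simp only [BoundedContinuousFunction.coe_neg, Pi.neg_apply] at this ⊢
      linarith
  · intro a ha
    obtain ⟨b, hb, hba⟩ := EReal.lt_iff_exists_real_btwn.1 ha
    rw [EReal.coe_lt_coe_iff] at hb
    filter_upwards [exists_integral_majorant hZ hτ hAEC hm hL hLm φ (sub_pos.2 hb)]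
      with n hn
    obtain ⟨U, hUm, hUi, hφU, hU⟩ := hn
    refine (outerExpectation_le_integral hUm hUi hφU).trans_lt (lt_trans ?_ hba)
    rw [EReal.coe_lt_coe_iff]
    linarith

end WeakConvergence

/-! ### Kolmogorov extension through compactness -/

section KolmogorovExtension

/-- The compact space of extended-real functions on `T`, with its Borel σ-field. -/
def ERealCube (T : Type*) := T → EReal

variable {T : Type*}

noncomputable instance : TopologicalSpace (ERealCube T) := inferInstanceAs (TopologicalSpace (T → EReal))

instance : CompactSpace (ERealCube T) := inferInstanceAs (CompactSpace (T → EReal))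

instance : T2Space (ERealCube T) := inferInstanceAs (T2Space (T → EReal))

noncomputable instance : MeasurableSpace (ERealCube T) := borel _

instance : BorelSpace (ERealCube T) := ⟨rfl⟩

open scoped Classical in
/-- Extension of a vector indexed by `I` by zero. -/
noncomputable def ERealCube.extend (I : Finset T) (x : I → ℝ) : ERealCube T := fun t =>
  if h : t ∈ I then ((x ⟨t, h⟩ : ℝ) : EReal) else 0

theorem ERealCube.continuous_extend (I : Finset T) : Continuous (ERealCube.extend I) := by
  refine continuous_pi (A := fun _ : T => EReal) fun t => ?_
  by_cases h : t ∈ I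
  · simp only [ERealCube.extend, h, dif_pos]
    exact continuous_coe_real_ereal.comp (continuous_apply _)
  · simp only [ERealCube.extend, h, dif_neg, not_false_eq_true]
    exact continuous_const

theorem ERealCube.continuous_eval (t : T) : Continuous fun c : ERealCube T => c t :=
  continuous_apply (A := fun _ : T => EReal) t

/-- **Kolmogorov extension theorem** for real-valued processes with an arbitrary index set. -/
theorem exists_isProjectiveLimit (m : (I : Finset T) → ProbabilityMeasure (I → ℝ))
    (hm : IsProjectiveMeasureFamily (α := fun _ : T => ℝ) fun I => (m I : Measure (I → ℝ))) :
    ∃ μ : Measure (T → ℝ), IsProbabilityMeasure μ ∧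
      IsProjectiveLimit (α := fun _ : T => ℝ) μ fun I => (m I : Measure (I → ℝ)) := by
  let f : Finset T → ProbabilityMeasure (ERealCube T) := fun I =>
    (m I).map (ERealCube.continuous_extend I).measurable.aemeasurable
  -- Laws on the compact cube form a compact space, so the zero-extended marginals converge along an
  -- ultrafilter. It refines `atTop`, so eventually `J ⊆ I` and the `J`-marginal is constant.
  let 𝒰 : Ultrafilter (Finset T) := Ultrafilter.of atTop
  obtain ⟨μ, -, hμ⟩ := isCompact_univ.ultrafilter_le_nhds (𝒰.map f) (by simp)
  have hlim : Tendsto f 𝒰 (𝓝 μ) := hμ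
  have hrestr : ∀ J : Finset T, Continuous fun (c : ERealCube T) (t : J) => c t := fun J =>
    continuous_pi fun t => ERealCube.continuous_eval (t : T)
  have hcoe : ∀ J : Finset T, Measurable fun (x : J → ℝ) (t : J) => ((x t : ℝ) : EReal) :=
    fun J => measurable_pi_lambda _ fun t => (measurable_pi_apply t).coe_real_ereal
  have hmarg : ∀ J : Finset T, (μ : Measure (ERealCube T)).map (fun c (t : J) => c t) =
      (m J : Measure (J → ℝ)).map fun x t => ((x t : ℝ) : EReal) := by
    intro J
    have h1 := ProbabilityMeasure.tendsto_map_of_tendsto_of_continuous f μ hlim (hrestr J)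
    have h2 : Tendsto (fun I => (f I).map (hrestr J).measurable.aemeasurable) 𝒰
        (𝓝 ((m J).map (hcoe J).aemeasurable)) := by
      refine tendsto_const_nhds.congr' ?_
      filter_upwards [Ultrafilter.of_le atTop (eventually_ge_atTop J)] with I hJI
      apply Subtype.ext
      change (m J : Measure (J → ℝ)).map (fun x t => ((x t : ℝ) : EReal)) =
        ((m I : Measure (I → ℝ)).map (ERealCube.extend I)).map fun c (t : J) => c t
      rw [Measure.map_map (hrestr J).measurable (ERealCube.continuous_extend I).measurable,
        show (m J : Measure (J → ℝ)) = _ from hm I J hJI,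
        Measure.map_map (hcoe J) (Finset.measurable_restrict₂ hJI)]
      congr 1
      ext x t
      simp [ERealCube.extend, hJI t.2]
    have h3 : μ.map (hrestr J).measurable.aemeasurable = (m J).map (hcoe J).aemeasurable :=
      tendsto_nhds_unique h1 h2
    exact congrArg Subtype.val h3
  -- The marginals of `μ` are images of laws on real vectors, so `toReal` recovers them.
  have hreal : Measurable fun (c : ERealCube T) (t : T) => (c t).toReal :=
    measurable_pi_lambda _ fun t => (ERealCube.continuous_eval t).measurable.ereal_toReal
  refine ⟨(μ : Measure (ERealCube T)).map fun c t => (c t).toReal,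
    Measure.isProbabilityMeasure_map hreal.aemeasurable, fun J => ?_⟩
  have htoReal : Measurable fun (y : J → EReal) (t : J) => (y t).toReal :=
    measurable_pi_lambda _ fun t => (measurable_pi_apply t).ereal_toReal
  have h1 := congrArg (Measure.map fun (y : J → EReal) (t : J) => (y t).toReal) (hmarg J)
  rw [Measure.map_map htoReal (hrestr J).measurable, Measure.map_map htoReal (hcoe J)] at h1
  rw [Measure.map_map (Finset.measurable_restrict J) hreal]
  refine h1.trans ?_
  convert! Measure.map_id using 2

end KolmogorovExtension

/-! ### Tightness of laws of strongly measurable maps -/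

section Tight

/-- The closure of the separable range is Polish, where every finite measure is tight; inclusion
preserves this. The ambient space, such as `LInf T`, need not be separable. -/
theorem isTightMeasureSet_map_of_stronglyMeasurable {Ω E : Type*} [MeasurableSpace Ω]
    {μ : Measure Ω} [IsFiniteMeasure μ] [MetricSpace E] [CompleteSpace E] [MeasurableSpace E]
    [BorelSpace E] {Y : Ω → E} (hY : StronglyMeasurable Y) :
    IsTightMeasureSet {μ.map Y} := by
  obtain ⟨V, hV⟩ : ∃ V, V = closure (Set.range Y) := ⟨_, rfl⟩
  have hVc : IsClosed V := hV ▸ isClosed_closure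
  have : CompleteSpace V := hVc.completeSpace_coe
  have : TopologicalSpace.SeparableSpace V :=
    (hV ▸ hY.isSeparable_range.closure : TopologicalSpace.IsSeparable V).separableSpace
  have : SecondCountableTopology V := UniformSpace.secondCountable_of_separable V
  have hYV : ∀ ω, Y ω ∈ V := fun ω => hV ▸ subset_closure (Set.mem_range_self ω)
  have hY' : Measurable fun ω => (⟨Y ω, hYV ω⟩ : V) := hY.measurable.subtype_mk
  have h := (isTightMeasureSet_singleton (μ := μ.map fun ω => (⟨Y ω, hYV ω⟩ : V))).map
    continuous_subtype_val
  rwa [Set.image_singleton, Measure.map_map measurable_subtype_coe hY'] at h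

end Tight

/-! ### Construction of the tight limit -/

section TightLimit

variable {T : Type*} {μ : Measure (T → ℝ)} {m : (I : Finset T) → ProbabilityMeasure (I → ℝ)}

theorem measure_oscillation_le
    (hμ : IsProjectiveLimit (α := fun _ : T => ℝ) μ fun I => (m I : Measure (I → ℝ)))
    {τ : T → T → ℝ} {δ ε : ℝ} {c : ℝ≥0∞} {I : Finset T}
    (hc : (m I : Measure (I → ℝ)) {x | OscExceeds (fun s t : I => τ s t) δ ε x} ≤ c) :
    μ {x | ∃ s ∈ I, ∃ t ∈ I, τ s t ≤ δ ∧ ε < |x s - x t|} ≤ c := by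
  refine le_trans (le_of_eq ?_) hc
  rw [← show μ.map I.restrict = (m I : Measure (I → ℝ)) from hμ I,
    Measure.map_apply (Finset.measurable_restrict I)
    (isOpen_oscExceeds_restrict τ δ ε I).measurableSet]
  congr 1
  ext x
  simp [OscExceeds, and_left_comm]

/-- If the finite-dimensional oscillations of a family of laws are uniformly small, the laws are
the marginals of a tight law on the space of bounded functions. -/
theorem exists_tight_hasMarginals {τ : T → T → ℝ} (hsemi : IsSemimetric τ)
    (hτ : IsTotallyBounded τ)
    (hm : IsProjectiveMeasureFamily (α := fun _ : T => ℝ) fun I => (m I : Measure (I → ℝ)))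
    (hosc : ∀ ε : ℝ, 0 < ε → ∀ η : ℝ≥0∞, 0 < η → ∃ δ : ℝ, 0 < δ ∧ ∀ I : Finset T,
      (m I : Measure (I → ℝ)) {x | OscExceeds (fun s t : I => τ s t) δ ε x} ≤ η) :
    ∃ L : ProbabilityMeasure (LInf T),
      IsTightMeasureSet {(L : Measure (LInf T))} ∧ HasMarginals L m := by
  classical
  obtain ⟨μ, hμprob, hμ⟩ := exists_isProjectiveLimit m hm
  have hδ' : ∀ r : ℕ, ∃ δ : ℝ, 0 < δ ∧ ∀ I : Finset T,
      (m I : Measure (I → ℝ)) {x | OscExceeds (fun s t : I => τ s t) δ ((1 / 2) ^ r) x} ≤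
        (1 / 2) ^ r :=
    fun r => hosc _ (by positivity) _ (ENNReal.pow_pos (by simp) r)
  choose δ hδ0 hδ using hδ'
  -- Consecutive net points of `t` lie within `η r + η (r + 1) ≤ 2 * η r ≤ δ r`; running minima
  -- provide the monotonicity.
  obtain ⟨η, hη0, hηδ, hηmono⟩ : ∃ η : ℕ → ℝ, (∀ r, 0 < η r) ∧ (∀ r, 2 * η r ≤ δ r) ∧
      ∀ r, η (r + 1) ≤ η r := by
    refine ⟨fun r => (Finset.range (r + 1)).inf' Finset.nonempty_range_add_one δ / 2,
      fun r => ?_, fun r => ?_, fun r => ?_⟩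
    · exact half_pos ((Finset.lt_inf'_iff _).2 fun i _ => hδ0 i)
    · have := Finset.inf'_le δ (Finset.self_mem_range_succ r)
      simp only
      linarith
    · have := Finset.inf'_mono δ (Finset.range_subset_range.2 (Nat.le_succ (r + 1)))
        Finset.nonempty_range_add_one
      simp only
      linarith
  choose A π hπ using fun r => hτ.exists_net (hη0 r)
  -- Borel–Cantelli with summable bounds `(1 / 2) ^ r`. It serves twice: consecutive nets give the
  -- Cauchy property, and a point with its net points identifies the limit there.
  have hBC : ∀ I : ℕ → Finset T, ∀ᵐ x ∂μ, ∀ᶠ r in atTop, ∀ s ∈ I r, ∀ t ∈ I r,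
      τ s t ≤ 2 * η r → |x s - x t| ≤ (1 / 2) ^ r := by
    intro I
    have hle : ∀ r, μ {x | ∃ s ∈ I r, ∃ t ∈ I r, τ s t ≤ 2 * η r ∧ (1 / 2) ^ r < |x s - x t|} ≤
        (1 / 2) ^ r := by
      intro r
      refine le_trans (measure_mono ?_) (measure_oscillation_le hμ (hδ r (I r)))
      rintro x ⟨s, hs, t, ht, hst, hlt⟩
      exact ⟨s, hs, t, ht, hst.trans (hηδ r), hlt⟩
    have hsum : ∑' r, μ {x | ∃ s ∈ I r, ∃ t ∈ I r, τ s t ≤ 2 * η r ∧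
        (1 / 2) ^ r < |x s - x t|} ≠ ⊤ := by
      refine ne_top_of_le_ne_top ?_ (ENNReal.tsum_le_tsum hle)
      rw [ENNReal.tsum_geometric]
      simp
    filter_upwards [ae_eventually_notMem hsum] with x hx
    filter_upwards [hx] with r hr s hs t ht hst
    by_contra! H
    exact hr ⟨s, hs, t, ht, hst, H⟩
  let Y : ℕ → (T → ℝ) → LInf T := fun r x => stepFun (π r) fun t => x t
  have hYm : ∀ r, StronglyMeasurable (Y r) := fun r =>
    (continuous_stepFun (π r)).comp_stronglyMeasurable
      (measurable_pi_lambda _ fun t => measurable_pi_apply _).stronglyMeasurable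
  have hYlim : ∀ᵐ x ∂μ, ∃ y, Tendsto (fun r => Y r x) atTop (𝓝 y) := by
    filter_upwards [hBC fun r => A r ∪ A (r + 1)] with x hx
    refine cauchySeq_tendsto_of_complete (cauchySeq_of_summable_dist ?_)
    refine Summable.of_norm_bounded_eventually_nat
      (summable_geometric_of_lt_one (r := (1 / 2 : ℝ)) (by norm_num) (by norm_num)) ?_
    filter_upwards [hx] with r hr
    rw [Real.norm_of_nonneg dist_nonneg, dist_eq_norm]
    refine lp.norm_le_of_forall_le (by positivity) fun t => ?_
    refine hr _ (Finset.mem_union_left _ (π r t).2) _ (Finset.mem_union_right _ (π (r + 1) t).2) ?_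
    have h1 := hsemi.triangle (π r t) t (π (r + 1) t)
    rw [hsemi.symm (π r t) t] at h1
    have h2 := hπ r t
    have h3 := hπ (r + 1) t
    have h4 := hηmono r
    linarith
  obtain ⟨Ylim, hYlimm, hYlimt⟩ := exists_stronglyMeasurable_limit_of_tendsto_ae
    (fun r => (hYm r).aestronglyMeasurable) hYlim
  -- The null set depends on `t`; this is enough, since marginals involve finitely many indices.
  have hversion : ∀ t : T, ∀ᵐ x ∂μ, Ylim x t = x t := by
    intro t
    filter_upwards [hYlimt, hBC fun r => {t, (π r t : T)}] with x hx1 hx2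
    have h1 : Tendsto (fun r => x (π r t)) atTop (𝓝 (Ylim x t)) :=
      ((continuous_eval t).tendsto _).comp hx1
    refine tendsto_nhds_unique h1 ?_
    rw [tendsto_iff_dist_tendsto_zero]
    refine squeeze_zero' (Eventually.of_forall fun _ => dist_nonneg) ?_
      (tendsto_pow_atTop_nhds_zero_of_lt_one (r := (1 / 2 : ℝ)) (by norm_num) (by norm_num))
    filter_upwards [hx2] with r hr
    rw [dist_comm, Real.dist_eq]
    refine hr t (by simp) _ (by simp) ((hπ r t).trans ?_)
    linarith [hη0 r]
  refine ⟨⟨μ.map Ylim, Measure.isProbabilityMeasure_map hYlimm.measurable.aemeasurable⟩,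
    isTightMeasureSet_map_of_stronglyMeasurable hYlimm, fun I => ?_⟩
  change (μ.map Ylim).map _ = _
  rw [Measure.map_map (continuous_restrict I).measurable hYlimm.measurable,
    ← show μ.map I.restrict = (m I : Measure (I → ℝ)) from hμ I]
  refine Measure.map_congr ?_
  have hall : ∀ᵐ x ∂μ, ∀ t : I, Ylim x t = x t := ae_all_iff.2 fun t => hversion t
  filter_upwards [hall] with x hx
  ext t
  exact hx t

end TightLimit

/-! ### The product semimetric and measurability of the process -/

section SequentialProcess

variable {𝒳 : Type*}

theorem isSemimetric_tau {F : Set (𝒳 → ℝ)} {ρ : F → F → ℝ} (hρ : IsSemimetric ρ) :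
    IsSemimetric (tau ρ) where
  nonneg p q := add_nonneg (abs_nonneg _) (hρ.nonneg _ _)
  self p := by simp [tau, hρ.self]
  symm p q := by
    unfold tau
    rw [abs_sub_comm, hρ.symm]
  triangle p q r := by
    have h1 := abs_sub_le (p.1 : ℝ) q.1 r.1
    have h2 := hρ.triangle p.2 q.2 r.2
    unfold tau
    linarith

theorem isTotallyBounded_tau {F : Set (𝒳 → ℝ)} {ρ : F → F → ℝ} (hρ : IsTotallyBounded ρ) :
    IsTotallyBounded (tau ρ) := by
  intro ε hε
  obtain ⟨A, hA⟩ := hρ (ε / 2) (half_pos hε)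
  obtain ⟨S, -, hSfin, hS⟩ := Metric.finite_approx_of_totallyBounded
    (isCompact_univ : IsCompact (Set.univ : Set (Set.Icc (0 : ℝ) 1))).totallyBounded
    (ε / 2) (half_pos hε)
  refine ⟨hSfin.toFinset ×ˢ A, fun p => ?_⟩
  obtain ⟨a, ha, hpa⟩ := hA p.2
  obtain ⟨s, hs, hps⟩ := Set.mem_iUnion₂.1 (hS (Set.mem_univ p.1))
  refine ⟨(s, a), Finset.mk_mem_product (hSfin.mem_toFinset.2 hs) ha, ?_⟩
  have h1 : |(p.1 : ℝ) - s| < ε / 2 := hps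
  unfold tau
  simp only
  linarith

theorem measurable_process {Ω : Type*} [MeasurableSpace Ω] [MeasurableSpace 𝒳] (P : Measure Ω)
    {X : ℕ → ℕ → Ω → 𝒳} (hX : ∀ n i, 1 ≤ i → i ≤ n → Measurable (X n i)) {F : Set (𝒳 → ℝ)}
    (hF : ∀ f ∈ F, Measurable f) (n : ℕ) (p : Idx F) :
    Measurable fun ω => process P X F n ω p := by
  unfold process centeredSum
  refine measurable_const.mul (Finset.measurable_fun_sum _ fun k hk => ?_)
  rw [Finset.mem_Icc] at hk
  exact ((hF _ p.2.2).comp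
    (hX n k hk.1 (hk.2.trans (floor_mul_le_of_mem_Icc n p.1)))).sub_const _

end SequentialProcess

end SeqEmp

theorem theorem2p2 {Ω : Type*} [MeasurableSpace Ω] (P : Measure Ω) [IsProbabilityMeasure P]
    {𝒳 : Type*} [MeasurableSpace 𝒳] (X : ℕ → ℕ → Ω → 𝒳)
    (hX : ∀ n i, 1 ≤ i → i ≤ n → Measurable (X n i))
    (F : Set (𝒳 → ℝ)) (hF : ∀ f ∈ F, Measurable f) (hEnv : SeqEmp.HasEnvelope P X F)
    (ν : ℝ) (hν : 2 < ν) (ρ : F → F → ℝ) (hρ : SeqEmp.IsSemimetric ρ)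
    -- moment bounds over the classes of differences
    (g : ℕ → ℝ → ℝ)
    (hg : ∀ (n : ℕ) (δ : ℝ), 0 < δ → ∀ i j : ℕ, 1 ≤ i → i ≤ j → j ≤ n →
      SeqEmp.outerExpectation P
          (fun ω => ((SeqEmp.supCenteredSum P X (SeqEmp.diffClass ρ δ) ν n i j ω : ENNReal) : EReal))
        ≤ ((g (j - i + 1) δ ^ (ν / 2) : ℝ) : EReal))
    (Qg : ℝ) (hgS : ∀ δ : ℝ, 0 < δ → SeqEmp.ConditionS (ν / 2) Qg (fun m => g m δ))
    -- moment bounds over the class itself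
    (h : ℕ → ℝ)
    (hh : ∀ n i j : ℕ, 1 ≤ i → i ≤ j → j ≤ n →
      SeqEmp.outerExpectation P
          (fun ω => ((SeqEmp.supCenteredSum P X F ν n i j ω : ENNReal) : EReal))
        ≤ ((h (j - i + 1) ^ (ν / 2) : ℝ) : EReal))
    (Qh : ℝ) (hhS : SeqEmp.ConditionS (ν / 2) Qh h)
    -- asymptotic behaviour of the bounds
    (hglim : Tendsto (fun δ : ℝ => limsup (fun n : ℕ => ((g n δ / n : ℝ) : EReal)) atTop)
      (𝓝[>] 0) (𝓝 0))
    (C : ℝ) (hC : 0 ≤ C)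
    (hhlim : ∀ ε : ℝ, 0 < ε → ε ≤ 1 →
      limsup (fun n : ℕ => ((h ⌊(n : ℝ) * ε⌋₊ / n : ℝ) : EReal)) atTop ≤ ((C * ε : ℝ) : EReal)) :
    SeqEmp.AEC P (SeqEmp.process P X F) (SeqEmp.tau ρ) ∧
    (SeqEmp.IsTotallyBounded ρ →
      ∀ m : (I : Finset (SeqEmp.Idx F)) → ProbabilityMeasure (I → ℝ),
        SeqEmp.FidiConverges P (SeqEmp.process P X F) m →
          (∃ L : ProbabilityMeasure (SeqEmp.LInf (SeqEmp.Idx F)),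
            IsTightMeasureSet {(L : Measure (SeqEmp.LInf (SeqEmp.Idx F)))} ∧
            SeqEmp.HasMarginals L m ∧
            SeqEmp.WeaklyConverges P (SeqEmp.processLInf hEnv) L) ∧
          (∀ L : ProbabilityMeasure (SeqEmp.LInf (SeqEmp.Idx F)),
            IsTightMeasureSet {(L : Measure (SeqEmp.LInf (SeqEmp.Idx F)))} →
            SeqEmp.HasMarginals L m →
            SeqEmp.WeaklyConverges P (SeqEmp.processLInf hEnv) L)) := by

  have hAEC := SeqEmp.aec_process P X hX F hF hEnv ν hν ρ hρ g hg Qg hgS h hh Qh hhS hglim C hC hhlim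
  refine ⟨hAEC, fun hρtb m hm => ?_⟩
  have hZ := fun n p => SeqEmp.measurable_process P hX hF n p
  have hτ := SeqEmp.isTotallyBounded_tau hρtb
  have hweak : ∀ L : ProbabilityMeasure (SeqEmp.LInf (SeqEmp.Idx F)),
      IsTightMeasureSet {(L : Measure (SeqEmp.LInf (SeqEmp.Idx F)))} →
      SeqEmp.HasMarginals L m → SeqEmp.WeaklyConverges P (SeqEmp.processLInf hEnv) L :=
    fun L hL hLm => SeqEmp.weaklyConverges_of_aec (Z := SeqEmp.processLInf hEnv) hZ hτ hAEC hm hL hLm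
  obtain ⟨L, hL, hLm⟩ := SeqEmp.exists_tight_hasMarginals (SeqEmp.isSemimetric_tau hρ) hτ
    hm.isProjectiveMeasureFamily (fun ε hε η hη => by
      obtain ⟨δ, hδ, hlim⟩ := hAEC.exists_limsup_lt hε hη
      exact ⟨δ, hδ, fun I => (hm.measure_oscExceeds_le hZ _ δ ε I).trans hlim.le⟩)
  exact ⟨⟨L, hL, hLm, hweak L hL hLm⟩, hweak⟩
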